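/- **Setting.** Let $n,m,p,L,N$ be natural numbers with $L\ge n$. Consider the LTI system $x_{k+1}=Ax_k+Bu_k$, $y_k=Cx_k+Du_k$ with $x_k\in\mathbb R^n$, $u_k\in\mathbb R^m$, $y_k\in\mathbb R^p$, where $(A,B)$ is controllable and $(A,C)$ is observable. Let $(u^{d},y^{d})=\{u^d_k,y^d_k\}_{k=0}^{N-1}$ be an input-output trajectory of it. For a sequence $w$ of length $N$ let $H_K(w)$ denote its block Hankel matrix with $K$ block rows and $N-K+1$ block columns, whose $(i,j)$ block is $w_{i+j}$, $i,j\ge 0$. Assume that $u^d$ is persistently exciting of order $L+2n$, i.e. $\operatorname{rank}H_{L+2n}(u^d)=m(L+2n)$. Let $Q,R\succ0$, and let $\mathbb U\subseteq\mathbb R^m$ be a compact convex polytope; the output is not constrained. Write $\|x\|_M^2=x^\top Mx$. Sequences $u,y$ below are indexed by $k=-n,\dots,L-1$, and $u,y,\sigma$ also denote the stacked vectors. *Nominal problem.* For $\xi=(u^{\rm ini},y^{\rm ini})\in\mathbb R^{(m+p)n}$, consisting of the last $n$ inputs and outputs, let $J_L^*(\xi)\in[0,\infty]$ be the infimum of $\sum_{k=0}^{L-1}\|\bar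 u_k\|_R^2+\|\bar y_k\|_Q^2$ over all $(\alpha,\bar u,\bar y)$ with $\bar u=H_{L+n}(u^d)\alpha$, $\bar y=H_{L+n}(y^d)\alpha$, $(\bar u_{[-n,-1]},\bar y_{[-n,-1]})=(u^{\rm ini},y^{\rm ini})$, $\bar u_k\in\mathbb U$ for $0\le k\le L-1$, and $\bar u_k=0$, $\bar y_k=0$ for $L-n\le k\le L-1$ ($J_L^*(\xi)=\infty$ if this problem is infeasible). *Lyapunov function.* Let $P\succ0$ and $c>0$ be such that $\|\xi_{t+1}\|_P^2-\|\xi_t\|_P^2\le-\|\xi_t\|_2^2+c(\|u_t\|_R^2+\|y_t\|_Q^2)$ along all system trajectories with inputs in $\mathbb U$, where $\xi_t=(u_{[t-n,t-1]},y_{[t-n,t-1]})$. Put $V(\xi)=J_L^*(\xi)+\frac1c\|\xi\|_P^2$. *Robust problem.* Let $\lambda_\alpha,\lambda_\sigma,\beta_\alpha,\beta_\sigma>0$ with $\beta_\alpha+\beta_\sigma<2$. For a noise level $\bar\varepsilon>0$, noise samples $\varepsilon^d_0,\dots,\varepsilon^d_{N-1},\varepsilon_1,\dots,\varepsilon_n\in\mathbb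 R^p$ of Euclidean norm at most $\bar\varepsilon$, $\tilde y^d=y^d+\varepsilon^d$ and $\tilde y^{\rm ini}=y^{\rm ini}+\varepsilon$, minimize $$\sum_{k=0}^{L-1}\|\hat u_k\|_R^2+\|\hat y_k\|_Q^2+\lambda_\alpha\bar\varepsilon^{\beta_\alpha}\|\hat\alpha\|_2^2+\frac{\lambda_\sigma}{\bar\varepsilon^{\beta_\sigma}}\|\hat\sigma\|_2^2$$ over all $(\hat\alpha,\hat\sigma,\hat u,\hat y)$ with $\hat u=H_{L+n}(u^d)\hat\alpha$, $\hat y+\hat\sigma=H_{L+n}(\tilde y^d)\hat\alpha$, $(\hat u_{[-n,-1]},\hat y_{[-n,-1]})=(u^{\rm ini},\tilde y^{\rm ini})$, $\hat u_k=0$, $\hat y_k=0$ for $L-n\le k\le L-1$, and $\hat u_k\in\mathbb U$ for $0\le k\le L-1$. **Theorem.** For every $\overline V>0$ there is a function $\beta_u\in\mathcal K_\infty$ (continuous, strictly increasing, unbounded, $\beta_u(0)=0$) such that for all $\bar\varepsilon>0$, all noise samples bounded by $\bar\varepsilon$ as above, and all $\xi$ with $V(\xi)\le\overline V$: both problems have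 optimal solutions, and the input sequence $\hat u^*$ of any optimal solution of the robust problem and the input sequence $\bar u^*$ of any optimal solution of the nominal problem satisfy $\|\hat u^*-\bar u^*\|_2\le\beta_u(\bar\varepsilon)$. -/

import Mathlib

open scoped NNReal Matrix

noncomputable section

namespace DDMPC

/-- The Euclidean norm `√(xᵀ x)` of a real vector. -/
def norm2 {ι : Type*} [Fintype ι] (x : ι → ℝ) : ℝ := ‖WithLp.toLp 2 x‖

/-- The squared weighted norm `‖x‖_P² = xᵀ P x`. -/
def wnormSq {ι : Type*} [Fintype ι] (P : Matrix ι ι ℝ) (x : ι → ℝ) : ℝ := x ⬝ᵥ (P *ᵥ x)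

/-- The stacked vector of all entries of a sequence. -/
def stack {K q : ℕ} (w : Fin K → Fin q → ℝ) : Fin K × Fin q → ℝ := fun i => w i.1 i.2

/-- Comparison functions of class `K∞`. -/
structure IsKInf (β : ℝ≥0 → ℝ≥0) : Prop where
  continuous : Continuous β
  strictMono : StrictMono β
  unbounded : ¬ BddAbove (Set.range β)
  map_zero : β 0 = 0

/-- The Hankel matrix `H_K(w)` of depth `K` of a sequence `w` of length `N`. It has `N - K + 1`
block columns (none if `N < K`); its `(i, j)` block is `w (i + j)`. -/
def hankel {N q : ℕ} (K : ℕ) (w : Fin N → Fin q → ℝ) :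
    Matrix (Fin K × Fin q) (Fin (N + 1 - K)) ℝ :=
  Matrix.of fun i j =>
    w ⟨i.1.val + j.val, by have h1 := i.1.isLt; have h2 := j.isLt; omega⟩ i.2

/-- Persistency of excitation of order `K`. -/
def PersistentlyExciting {N m : ℕ} (K : ℕ) (u : Fin N → Fin m → ℝ) : Prop :=
  (hankel K u).rank = m * K

/-- The matrices of the system `x⁺ = A x + B u`, `y = C x + D u`. -/
structure LTI (n m p : ℕ) where
  A : Matrix (Fin n) (Fin n) ℝ
  B : Matrix (Fin n) (Fin m) ℝ
  C : Matrix (Fin p) (Fin n) ℝ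
  D : Matrix (Fin p) (Fin m) ℝ

/-- `(A, B)` is controllable: `[B, AB, …, A^(n-1) B]` has rank `n`. -/
def LTI.Controllable {n m p : ℕ} (S : LTI n m p) : Prop :=
  (Matrix.of fun (i : Fin n) (j : Fin n × Fin m) => (S.A ^ j.1.val * S.B) i j.2).rank = n

/-- `(A, C)` is observable: `[C; CA; …; C A^(n-1)]` has rank `n`. -/
def LTI.Observable {n m p : ℕ} (S : LTI n m p) : Prop :=
  (Matrix.of fun (i : Fin n × Fin p) (j : Fin n) => (S.C * S.A ^ i.1.val) i.2 j).rank = n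

/-- `(u, y)` is an input-output trajectory of length `K` of the system. -/
def LTI.IsTrajectory {n m p K : ℕ} (S : LTI n m p)
    (u : Fin K → Fin m → ℝ) (y : Fin K → Fin p → ℝ) : Prop :=
  ∃ x : ℕ → Fin n → ℝ, ∀ k : Fin K,
    x (k.val + 1) = S.A *ᵥ x k.val + S.B *ᵥ u k ∧ y k = S.C *ᵥ x k.val + S.D *ᵥ u k

/-- A polytope: a compact set described by finitely many affine inequalities
(such a set is convex). -/
def IsPolytope {m : ℕ} (U : Set (Fin m → ℝ)) : Prop :=
  IsCompact U ∧ ∃ (r : ℕ) (G : Matrix (Fin r) (Fin m) ℝ) (g : Fin r → ℝ),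
    U = {v | G *ᵥ v ≤ g}

/-- The extended state formed by the last `n` inputs and outputs. -/
structure ExtState (n m p : ℕ) where
  u : Fin n → Fin m → ℝ
  y : Fin n → Fin p → ℝ

/-- The extended state as a vector with `(m + p) n` entries. -/
def ExtState.vec {n m p : ℕ} (ξ : ExtState n m p) : (Fin n × Fin m) ⊕ (Fin n × Fin p) → ℝ :=
  Sum.elim (stack ξ.u) (stack ξ.y)

/-- The extended state whose output measurements are corrupted by `ε`. -/
def ExtState.addNoise {n m p : ℕ} (ξ : ExtState n m p) (ε : Fin n → Fin p → ℝ) :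
    ExtState n m p := ⟨ξ.u, ξ.y + ε⟩

/-- Running cost `∑_{k=0}^{L-1} ‖u_k‖_R² + ‖y_k‖_Q²` of sequences indexed from `-n` to `L - 1`.
Throughout, time `k ∈ [-n, L-1]` is stored at position `k + n`, that is, past samples sit at
`Fin.castAdd L i` and predicted samples at `Fin.natAdd n k`. -/
def runningCost {n m p L : ℕ} (Q : Matrix (Fin p) (Fin p) ℝ) (R : Matrix (Fin m) (Fin m) ℝ)
    (u : Fin (n + L) → Fin m → ℝ) (y : Fin (n + L) → Fin p → ℝ) : ℝ :=
  ∑ k : Fin L, (wnormSq R (u (Fin.natAdd n k)) + wnormSq Q (y (Fin.natAdd n k)))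

/-- The first `n` samples of `(u, y)` agree with the extended state `ξ`. -/
def InitialCondition {n m p L : ℕ} (ξ : ExtState n m p)
    (u : Fin (n + L) → Fin m → ℝ) (y : Fin (n + L) → Fin p → ℝ) : Prop :=
  ∀ i : Fin n, u (Fin.castAdd L i) = ξ.u i ∧ y (Fin.castAdd L i) = ξ.y i

/-- The terminal equality constraint `u_k = 0`, `y_k = 0` for `k ∈ [L-n, L-1]`. -/
def TerminalConstraint {n m p L : ℕ}
    (u : Fin (n + L) → Fin m → ℝ) (y : Fin (n + L) → Fin p → ℝ) : Prop :=
  ∀ k : Fin L, L ≤ k.val + n → u (Fin.natAdd n k) = 0 ∧ y (Fin.natAdd n k) = 0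

/-- Decision variables of the nominal problem. -/
structure NominalVar (n m p L N : ℕ) where
  α : Fin (N + 1 - (n + L)) → ℝ
  u : Fin (n + L) → Fin m → ℝ
  y : Fin (n + L) → Fin p → ℝ

/-- Constraints of the nominal data-driven MPC problem with data `(ud, yd)`. -/
structure NominalFeasible {n m p L N : ℕ} (U : Set (Fin m → ℝ)) (Y : Set (Fin p → ℝ))
    (ud : Fin N → Fin m → ℝ) (yd : Fin N → Fin p → ℝ) (ξ : ExtState n m p)
    (z : NominalVar n m p L N) : Prop where
  hankel_u : stack z.u = hankel (n + L) ud *ᵥ z.α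
  hankel_y : stack z.y = hankel (n + L) yd *ᵥ z.α
  initial : InitialCondition ξ z.u z.y
  constraints : ∀ k : Fin L, z.u (Fin.natAdd n k) ∈ U ∧ z.y (Fin.natAdd n k) ∈ Y
  terminal : TerminalConstraint z.u z.y

/-- Optimal solutions of the nominal problem. -/
def NominalOptimal {n m p L N : ℕ} (Q : Matrix (Fin p) (Fin p) ℝ) (R : Matrix (Fin m) (Fin m) ℝ)
    (U : Set (Fin m → ℝ)) (Y : Set (Fin p → ℝ))
    (ud : Fin N → Fin m → ℝ) (yd : Fin N → Fin p → ℝ) (ξ : ExtState n m p)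
    (z : NominalVar n m p L N) : Prop :=
  NominalFeasible U Y ud yd ξ z ∧
    ∀ z' : NominalVar n m p L N, NominalFeasible U Y ud yd ξ z' →
      runningCost Q R z.u z.y ≤ runningCost Q R z'.u z'.y

/-- The optimal cost `J_L*(ξ)` of the nominal problem; it is `⊤` if the problem is infeasible. -/
def nominalValue {n m p N : ℕ} (L : ℕ) (Q : Matrix (Fin p) (Fin p) ℝ)
    (R : Matrix (Fin m) (Fin m) ℝ) (U : Set (Fin m → ℝ)) (Y : Set (Fin p → ℝ))
    (ud : Fin N → Fin m → ℝ) (yd : Fin N → Fin p → ℝ) (ξ : ExtState n m p) : EReal :=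
  ⨅ (z : NominalVar n m p L N) (_ : NominalFeasible U Y ud yd ξ z),
    ((runningCost Q R z.u z.y : ℝ) : EReal)

/-- `W(ξ) = ‖ξ‖_P²` is an input-output-to-state-stability Lyapunov function with constant `c`:
`W(ξ_{t+1}) - W(ξ_t) ≤ -‖ξ_t‖² + c (‖u_t‖_R² + ‖y_t‖_Q²)` along all trajectories that satisfy
the constraints. The sequences below cover the times `t - n, …, t`. -/
def IsIOSS {n m p : ℕ} (S : LTI n m p) (Q : Matrix (Fin p) (Fin p) ℝ)
    (R : Matrix (Fin m) (Fin m) ℝ) (U : Set (Fin m → ℝ)) (Y : Set (Fin p → ℝ))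
    (P : Matrix ((Fin n × Fin m) ⊕ (Fin n × Fin p)) ((Fin n × Fin m) ⊕ (Fin n × Fin p)) ℝ)
    (c : ℝ) : Prop :=
  ∀ (u : Fin (n + 1) → Fin m → ℝ) (y : Fin (n + 1) → Fin p → ℝ),
    S.IsTrajectory u y → (∀ k, u k ∈ U ∧ y k ∈ Y) →
      wnormSq P (ExtState.vec ⟨fun i => u i.succ, fun i => y i.succ⟩)
          - wnormSq P (ExtState.vec ⟨fun i => u i.castSucc, fun i => y i.castSucc⟩)
        ≤ -(norm2 (ExtState.vec ⟨fun i => u i.castSucc, fun i => y i.castSucc⟩)) ^ 2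
          + c * (wnormSq R (u (Fin.last n)) + wnormSq Q (y (Fin.last n)))

/-- The Lyapunov function `V(ξ) = J_L*(ξ) + (1 / c) ‖ξ‖_P²`. -/
def lyapunov {n m p N : ℕ} (L : ℕ) (Q : Matrix (Fin p) (Fin p) ℝ)
    (R : Matrix (Fin m) (Fin m) ℝ) (U : Set (Fin m → ℝ)) (Y : Set (Fin p → ℝ))
    (ud : Fin N → Fin m → ℝ) (yd : Fin N → Fin p → ℝ)
    (P : Matrix ((Fin n × Fin m) ⊕ (Fin n × Fin p)) ((Fin n × Fin m) ⊕ (Fin n × Fin p)) ℝ)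
    (c : ℝ) (ξ : ExtState n m p) : EReal :=
  nominalValue L Q R U Y ud yd ξ + ((1 / c * wnormSq P ξ.vec : ℝ) : EReal)

/-- Decision variables of the robust problem. -/
structure RobustVar (n m p L N : ℕ) where
  α : Fin (N + 1 - (n + L)) → ℝ
  σ : Fin (n + L) → Fin p → ℝ
  u : Fin (n + L) → Fin m → ℝ
  y : Fin (n + L) → Fin p → ℝ

/-- Regularization parameters of the robust problem. -/
structure RegParams where
  lamα : ℝ
  lamσ : ℝ
  βα : ℝ
  βσ : ℝ
  lamα_pos : 0 < lamα
  lamσ_pos : 0 < lamσ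
  βα_pos : 0 < βα
  βσ_pos : 0 < βσ

/-- Constraints of the robust data-driven MPC problem with (noisy) data `(ud, yd)` and (noisy)
extended state `ξ`. -/
structure RobustFeasible {n m p L N : ℕ} (U : Set (Fin m → ℝ))
    (ud : Fin N → Fin m → ℝ) (yd : Fin N → Fin p → ℝ) (ξ : ExtState n m p)
    (z : RobustVar n m p L N) : Prop where
  hankel_u : stack z.u = hankel (n + L) ud *ᵥ z.α
  hankel_y : stack (z.y + z.σ) = hankel (n + L) yd *ᵥ z.α
  initial : InitialCondition ξ z.u z.y
  terminal : TerminalConstraint z.u z.y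
  constraints : ∀ k : Fin L, z.u (Fin.natAdd n k) ∈ U

/-- The cost of the robust problem for the noise level `ε`. -/
def robustCost {n m p L N : ℕ} (Q : Matrix (Fin p) (Fin p) ℝ) (R : Matrix (Fin m) (Fin m) ℝ)
    (reg : RegParams) (ε : ℝ) (z : RobustVar n m p L N) : ℝ :=
  runningCost Q R z.u z.y + reg.lamα * ε ^ reg.βα * norm2 z.α ^ 2
    + reg.lamσ / ε ^ reg.βσ * norm2 (stack z.σ) ^ 2

/-- Optimal solutions of the robust problem for the noise level `ε`. -/
def RobustOptimal {n m p L N : ℕ} (Q : Matrix (Fin p) (Fin p) ℝ) (R : Matrix (Fin m) (Fin m) ℝ)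
    (U : Set (Fin m → ℝ)) (reg : RegParams) (ε : ℝ)
    (ud : Fin N → Fin m → ℝ) (yd : Fin N → Fin p → ℝ) (ξ : ExtState n m p)
    (z : RobustVar n m p L N) : Prop :=
  RobustFeasible U ud yd ξ z ∧
    ∀ z' : RobustVar n m p L N, RobustFeasible U ud yd ξ z' →
      robustCost Q R reg ε z ≤ robustCost Q R reg ε z'

end DDMPC

end

open scoped NNReal Matrix

noncomputable section

namespace DDMPC

/-! The argument compares optimal costs and then uses strong convexity. Write J for the running
cost, J* for the nominal optimum and ε ≤ 1 for the noise level; all constants are uniform over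
bounded ξ with bounded J*, which is what the bound on the Lyapunov function supplies.

A nominal optimum is generated by some α of bounded norm. Letting the slack absorb the noise turns
it into a feasible point of the robust problem whose regularization costs O(ε^βα + ε^(2-βσ))
(`exists_robustCost_le`). Hence J(û, ŷ) ≤ J* + O(ε^g) for a small g > 0. The same cost bound gives
‖α̂‖ = O(ε^(-βα/2)) and ‖σ̂‖ = O(ε^(βσ/2)), so the robust solution violates the noise-free dynamics
only by O(ε^(βσ/2) + ε^(1-βα/2)) (`exists_norm_signal_sub_le`); βα + βσ < 2 keeps all these
exponents positive.

Since the input set is polyhedral, Hoffman's error bound gives a nominally feasible z within O(ε^g)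
of the robust solution (`exists_nominalFeasible_near`). Its constant depends on the matrices and not
on the right-hand sides, where ξ enters. Thus J(z) ≤ J* + O(ε^g), and the parallelogram identity at
the midpoint of z and the nominal optimum bounds their input distance by O(ε^(g/2)). For ε ≥ 1
boundedness of the input set is enough, so βu can be a multiple of a power
(`exists_norm_sub_le_rpow`). -/

/-! ### Error bounds for linear inequalities. -/

/-- Clamping a real number to a nonempty interval given by finitely many bounds. -/
theorem exists_between_near {ι κ : Type*} [Finite ι] [Finite κ] (l : ι → ℝ) (u : κ → ℝ)
    (hlu : ∀ i j, l i ≤ u j) (x r : ℝ) (hr : 0 ≤ r) (hl : ∀ i, l i - r ≤ x)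
    (hu : ∀ j, x ≤ u j + r) :
    ∃ s, (∀ i, l i ≤ s) ∧ (∀ j, s ≤ u j) ∧ |s - x| ≤ r := by
  by_cases h1 : ∃ i, x < l i
  · obtain ⟨i₁, hi₁⟩ := h1
    have : Nonempty ι := ⟨i₁⟩
    obtain ⟨i₀, hi₀⟩ := Finite.exists_max l
    refine ⟨l i₀, hi₀, hlu i₀, abs_le.2 ⟨?_, ?_⟩⟩ <;> linarith [hi₀ i₁, hl i₀]
  by_cases h2 : ∃ j, u j < x
  · obtain ⟨j₁, hj₁⟩ := h2
    have : Nonempty κ := ⟨j₁⟩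
    obtain ⟨j₀, hj₀⟩ := Finite.exists_min u
    refine ⟨u j₀, fun i => hlu i j₀, hj₀, abs_le.2 ⟨?_, ?_⟩⟩ <;> linarith [hj₀ j₁, hu j₀]
  push Not at h1 h2
  exact ⟨x, h1, h2, by simpa using hr⟩

/-- **Hoffman's error bound** for a system of linear inequalities, by Fourier–Motzkin
elimination. -/
theorem hoffman_rows {q : ℕ} : ∀ {ι : Type} [Finite ι] (a : ι → Fin q → ℝ),
    ∃ C : ℝ, 0 ≤ C ∧ ∀ (b : ι → ℝ) (z : Fin q → ℝ), (∀ i, a i ⬝ᵥ z ≤ b i) →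
      ∀ (x : Fin q → ℝ) (t : ℝ), 0 ≤ t → (∀ i, a i ⬝ᵥ x ≤ b i + t) →
        ∃ x' : Fin q → ℝ, (∀ i, a i ⬝ᵥ x' ≤ b i) ∧ ∀ j, |x' j - x j| ≤ C * t := by
  induction q with
  | zero =>
    intro ι _ a
    exact ⟨0, le_rfl, fun b z hz x t ht _ => ⟨z, hz, fun j => j.elim0⟩⟩
  | succ q ih =>
    intro ι _ a
    have := Fintype.ofFinite ι
    let c : ι → ℝ := fun i => a i 0
    let a' : ι → Fin q → ℝ := fun i j => a i j.succ
    have split : ∀ i (x : Fin (q + 1) → ℝ), a i ⬝ᵥ x = c i * x 0 + a' i ⬝ᵥ (fun j => x j.succ) := by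
      intro i x
      simp [dotProduct, Fin.sum_univ_succ, c, a']
    -- A row with positive and a row with negative leading coefficient are scaled and added so that
    -- the first coordinate cancels; rows without it are kept.
    let κ := {ij : ι × ι // 0 < c ij.1 ∧ c ij.2 < 0} ⊕ {i : ι // c i = 0}
    let a'' : κ → Fin q → ℝ := Sum.elim
      (fun ij => (1 / c ij.1.1) • a' ij.1.1 + (-1 / c ij.1.2) • a' ij.1.2) (fun i => a' i.1)
    obtain ⟨C, hC, H⟩ := ih a''
    -- bounds on the inverse coefficients and on the rows
    obtain ⟨D, hD⟩ : ∃ D, ∀ i, |1 / c i| ≤ D := by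
      obtain ⟨D, hD⟩ := (Set.finite_range fun i => |1 / c i|).bddAbove
      exact ⟨D, fun i => hD ⟨i, rfl⟩⟩
    obtain ⟨W, hW⟩ : ∃ W, ∀ i, ∑ j, |a' i j| ≤ W := by
      obtain ⟨D, hD⟩ := (Set.finite_range fun i => ∑ j, |a' i j|).bddAbove
      exact ⟨D, fun i => hD ⟨i, rfl⟩⟩
    let D' := max D 0
    let W' := max W 0
    have hD' : ∀ i, |1 / c i| ≤ D' := fun i => (hD i).trans (le_max_left _ _)
    have hW' : ∀ i, ∑ j, |a' i j| ≤ W' := fun i => (hW i).trans (le_max_left _ _)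
    have hD0 : 0 ≤ D' := le_max_right _ _
    have hW0 : 0 ≤ W' := le_max_right _ _
    let K := C * (1 + 2 * D')
    have hK : 0 ≤ K := by positivity
    let K' := D' * (1 + W' * K)
    have hK' : 0 ≤ K' := by positivity
    refine ⟨K + K', by positivity, fun b z hz x t ht hx => ?_⟩
    let b'' : κ → ℝ := Sum.elim
      (fun ij => (1 / c ij.1.1) * b ij.1.1 + (-1 / c ij.1.2) * b ij.1.2) (fun i => b i.1)
    -- A kept row is violated by at most s, a combined row by at most D' * s from each of its two
    -- parents.
    have elim : ∀ (w : Fin (q + 1) → ℝ) (s : ℝ), 0 ≤ s → (∀ i, a i ⬝ᵥ w ≤ b i + s) →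
        ∀ k, a'' k ⬝ᵥ (fun j => w j.succ) ≤ b'' k + (1 + 2 * D') * s := by
      rintro w s hs hw (⟨⟨i, j⟩, hi, hj⟩ | ⟨i, hi⟩)
      · have h1 := hw i
        have h2 := hw j
        rw [split] at h1 h2
        simp only [a'', b'', Sum.elim_inl, add_dotProduct, smul_dotProduct, smul_eq_mul] at hi hj ⊢
        have hi' : 0 < 1 / c i := by positivity
        have hj' : 0 < -1 / c j := div_pos_of_neg_of_neg (by norm_num) hj
        have g1 := mul_le_mul_of_nonneg_left h1 hi'.le
        have g2 := mul_le_mul_of_nonneg_left h2 hj'.le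
        have e1 : 1 / c i * (c i * w 0) = w 0 := by field_simp
        have e2 : -1 / c j * (c j * w 0) = - w 0 := by field_simp [hj.ne]
        have f1 : 1 / c i * s ≤ D' * s := mul_le_mul_of_nonneg_right ((le_abs_self _).trans (hD' i)) hs
        have f2 : -1 / c j * s ≤ D' * s := by
          refine mul_le_mul_of_nonneg_right (le_trans ?_ (hD' j)) hs
          rw [neg_div]; exact neg_le_abs _
        rw [mul_add, mul_add] at g1 g2
        linarith
      · have h1 := hw i
        rw [split] at h1
        simp only [a'', b'', Sum.elim_inr] at hi ⊢
        rw [hi] at h1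
        have : 0 ≤ D' * s := by positivity
        linarith
    -- The point `z` serves only to show that the eliminated system is feasible. The corrected tail
    -- `y` is within K * t of the tail of `x`.
    obtain ⟨y, hy, hyx⟩ := H b'' (fun j => z j.succ)
      (fun k => by simpa using elim z 0 le_rfl (by simpa using hz) k)
      (fun j => x j.succ) ((1 + 2 * D') * t) (by positivity) (elim x t ht hx)
    have hyx' : ∀ j, |y j - x j.succ| ≤ K * t := fun j => (hyx j).trans_eq (by simp only [K]; ring)
    have hdot : ∀ i, |a' i ⬝ᵥ y - a' i ⬝ᵥ (fun j => x j.succ)| ≤ W' * (K * t) := by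
      intro i
      rw [← dotProduct_sub]
      calc |a' i ⬝ᵥ (y - fun j => x j.succ)| ≤ ∑ j, |a' i j * (y j - x j.succ)| :=
            Finset.abs_sum_le_sum_abs _ _
        _ ≤ ∑ j, |a' i j| * (K * t) := Finset.sum_le_sum fun j _ => by
            rw [abs_mul]; exact mul_le_mul_of_nonneg_left (hyx' j) (abs_nonneg _)
        _ = (∑ j, |a' i j|) * (K * t) := by rw [Finset.sum_mul]
        _ ≤ W' * (K * t) := mul_le_mul_of_nonneg_right (hW' i) (by positivity)
    have hviol : ∀ i, c i * x 0 + a' i ⬝ᵥ y - b i ≤ (1 + W' * K) * t := by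
      intro i
      have h1 := hx i
      rw [split] at h1
      have h2 := (abs_le.1 (hdot i)).2
      linarith
    have hdiv : ∀ i, |1 / c i| * ((1 + W' * K) * t) ≤ K' * t := by
      intro i
      have := mul_le_mul_of_nonneg_right (hD' i) (show 0 ≤ (1 + W' * K) * t by positivity)
      simp only [K']; linarith
    -- Given `y`, rows with c < 0 bound the first coordinate below and rows with c > 0 bound it
    -- above. The combined rows say that these bounds are compatible, and `x 0` misses each by at
    -- most K' * t, so it can be clamped.
    obtain ⟨s, hls, hsu, hsx⟩ := exists_between_near
      (fun j : {j : ι // c j < 0} => (b j.1 - a' j.1 ⬝ᵥ y) / c j.1)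
      (fun i : {i : ι // 0 < c i} => (b i.1 - a' i.1 ⬝ᵥ y) / c i.1)
      (fun j i => by
        have := hy (Sum.inl ⟨(i.1, j.1), i.2, j.2⟩)
        simp only [a'', b'', Sum.elim_inl, add_dotProduct, smul_dotProduct, smul_eq_mul] at this
        have e1 : (b j.1 - a' j.1 ⬝ᵥ y) / c j.1 = - (-1 / c j.1 * (b j.1 - a' j.1 ⬝ᵥ y)) := by ring
        have e2 : (b i.1 - a' i.1 ⬝ᵥ y) / c i.1 = (1 / c i.1 * (b i.1 - a' i.1 ⬝ᵥ y)) := by ring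
        rw [e1, e2]
        linarith)
      (x 0) (K' * t) (by positivity)
      (fun j => by
        have h1 := hviol j.1
        have h2 := hdiv j.1
        have hj := j.2
        rw [sub_le_iff_le_add, div_le_iff_of_neg hj]
        rw [abs_of_neg (one_div_neg.2 hj)] at h2
        have h3 : (1 + W' * K) * t ≤ - c j.1 * (K' * t) := by
          have := mul_le_mul_of_nonneg_left h2 (neg_pos.2 hj).le
          have e : -c j.1 * (-(1 / c j.1) * ((1 + W' * K) * t)) = (1 + W' * K) * t := by
            field_simp [hj.ne]
          linarith
        linarith)
      (fun i => by
        have h1 := hviol i.1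
        have h2 := hdiv i.1
        have hi := i.2
        rw [← sub_le_iff_le_add, le_div_iff₀ hi]
        rw [abs_of_pos (one_div_pos.2 hi)] at h2
        have h3 : (1 + W' * K) * t ≤ c i.1 * (K' * t) := by
          have := mul_le_mul_of_nonneg_left h2 hi.le
          have e : c i.1 * ((1 / c i.1) * ((1 + W' * K) * t)) = (1 + W' * K) * t := by
            field_simp [hi.ne]
          linarith
        linarith)
    refine ⟨Fin.cons s y, fun i => ?_, fun j => ?_⟩
    · rw [split]
      simp only [Fin.cons_zero, Fin.cons_succ]
      rcases lt_trichotomy (c i) 0 with h | h | h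
      · have := hls ⟨i, h⟩
        simp only [div_le_iff_of_neg h] at this
        linarith
      · have := hy (Sum.inr ⟨i, h⟩)
        simp only [a'', b'', Sum.elim_inr] at this
        rw [h]; linarith
      · have := hsu ⟨i, h⟩
        simp only [le_div_iff₀ h] at this
        linarith
    · refine Fin.cases ?_ (fun j => ?_) j
      · simp only [Fin.cons_zero]
        exact hsx.trans (mul_le_mul_of_nonneg_right (by linarith) ht)
      · simp only [Fin.cons_succ]
        exact (hyx' j).trans (mul_le_mul_of_nonneg_right (by linarith) ht)

/-- Hoffman's error bound for linear inequalities and equations, where only the equations are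
violated. -/
theorem hoffman {q : ℕ} {ι : Type} [Finite ι] {F : Type*} [NormedAddCommGroup F] [NormedSpace ℝ F]
    [FiniteDimensional ℝ F] (A : (Fin q → ℝ) →ₗ[ℝ] (ι → ℝ)) (E : (Fin q → ℝ) →ₗ[ℝ] F) :
    ∃ C : ℝ, 0 ≤ C ∧ ∀ (b : ι → ℝ) (d : F) (z : Fin q → ℝ), A z ≤ b → E z = d →
      ∀ x : Fin q → ℝ, A x ≤ b → ∃ x', A x' ≤ b ∧ E x' = d ∧ ‖x' - x‖ ≤ C * ‖E x - d‖ := by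
  let e : F ≃L[ℝ] (Fin (Module.finrank ℝ F) → ℝ) := ContinuousLinearEquiv.ofFinrankEq (by simp)
  let κ := Fin (Module.finrank ℝ F)
  let row : ((Fin q → ℝ) →ₗ[ℝ] ℝ) → Fin q → ℝ := fun φ j => φ (Pi.single j 1)
  have hrow : ∀ φ x, row φ ⬝ᵥ x = φ x := by
    intro φ x
    conv_rhs => rw [pi_eq_sum_univ' x]
    simp only [map_sum, dotProduct, row]
    refine Finset.sum_congr rfl fun j _ => ?_
    rw [map_smul, smul_eq_mul, mul_comm]
  let f : κ → (Fin q → ℝ) →ₗ[ℝ] ℝ := fun k => LinearMap.proj k ∘ₗ e.toLinearMap ∘ₗ E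
  -- Each equation, in the coordinates given by `e`, becomes two opposite inequalities.
  obtain ⟨C, hC, H⟩ := hoffman_rows (ι := ι ⊕ (κ ⊕ κ))
    (Sum.elim (fun i => row (LinearMap.proj i ∘ₗ A))
      (Sum.elim (fun k => row (f k)) (fun k => row (-f k))))
  refine ⟨C * ‖(e : F →L[ℝ] (κ → ℝ))‖, by positivity, fun b d z hz hzd x hx => ?_⟩
  have key : ∀ k, |e (E x) k - e d k| ≤ ‖(e : F →L[ℝ] (κ → ℝ))‖ * ‖E x - d‖ := by
    intro k
    have h1 := norm_le_pi_norm ((e : F →L[ℝ] (κ → ℝ)) (E x - d)) k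
    have h2 := (e : F →L[ℝ] (κ → ℝ)).le_opNorm (E x - d)
    simp only [map_sub, Pi.sub_apply, Real.norm_eq_abs] at h1
    simp only [map_sub] at h2
    exact h1.trans h2
  obtain ⟨x', hx', hd⟩ := H (Sum.elim b (Sum.elim (e d) (-(e d)))) z
    (by
      rintro (i | k | k)
      · simpa [hrow] using hz i
      · simp [hrow, f, hzd]
      · simp [hrow, f, hzd])
    x (‖(e : F →L[ℝ] (κ → ℝ))‖ * ‖E x - d‖) (by positivity)
    (by
      rintro (i | k | k)
      · have : 0 ≤ ‖(e : F →L[ℝ] (κ → ℝ))‖ * ‖E x - d‖ := by positivity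
        simp only [Sum.elim_inl, hrow]
        have := hx i
        simp only [LinearMap.comp_apply, LinearMap.proj_apply]
        linarith
      · have := (abs_le.1 (key k)).2
        simp only [Sum.elim_inl, Sum.elim_inr, hrow]
        simp only [f, LinearMap.comp_apply, LinearMap.proj_apply]
        change e (E x) k ≤ _
        linarith
      · have := (abs_le.1 (key k)).1
        simp only [Sum.elim_inr, hrow]
        simp only [f, LinearMap.neg_apply, LinearMap.comp_apply, LinearMap.proj_apply,
          Pi.neg_apply]
        change - e (E x) k ≤ _
        linarith)
  refine ⟨x', fun i => ?_, ?_, ?_⟩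
  · have := hx' (Sum.inl i)
    simpa [hrow] using this
  · apply e.injective
    ext k
    have h1 := hx' (Sum.inr (Sum.inl k))
    have h2 := hx' (Sum.inr (Sum.inr k))
    simp only [Sum.elim_inl, Sum.elim_inr, hrow, LinearMap.neg_apply, Pi.neg_apply,
      neg_le_neg_iff] at h1 h2
    exact le_antisymm h1 h2
  · rw [mul_assoc]
    exact (pi_norm_le_iff_of_nonneg (by positivity)).2 hd

/-- Every vector in the range of a linear map has a preimage of comparable norm. -/
theorem exists_preimage_norm_le {q : ℕ} {F : Type*} [NormedAddCommGroup F] [NormedSpace ℝ F]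
    [FiniteDimensional ℝ F] (E : (Fin q → ℝ) →ₗ[ℝ] F) :
    ∃ C : ℝ, 0 ≤ C ∧ ∀ x, ∃ x', E x' = E x ∧ ‖x'‖ ≤ C * ‖E x‖ := by
  -- With no inequalities, correcting the point 0 gives a preimage whose norm is controlled by the
  -- residual ‖E x‖.
  obtain ⟨C, hC, H⟩ := hoffman (ι := Empty) 0 E
  refine ⟨C, hC, fun x => ?_⟩
  obtain ⟨x', -, h1, h2⟩ := H 0 (E x) x le_rfl rfl 0 (by simp)
  exact ⟨x', h1, by simpa using h2⟩

/-! ### Comparison of Euclidean and sup norms; ‖·‖ on function types is the sup norm. -/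

section Norms

variable {ι : Type*} [Fintype ι]

theorem norm2_nonneg (x : ι → ℝ) : 0 ≤ norm2 x := norm_nonneg _

theorem norm_le_norm2 (x : ι → ℝ) : ‖x‖ ≤ norm2 x :=
  (pi_norm_le_iff_of_nonneg (norm2_nonneg x)).2 fun i => PiLp.norm_apply_le (WithLp.toLp 2 x) i

theorem norm2_sq_le (x : ι → ℝ) : norm2 x ^ 2 ≤ Fintype.card ι * ‖x‖ ^ 2 := by
  rw [norm2, EuclideanSpace.norm_sq_eq]
  calc ∑ i, ‖x i‖ ^ 2 ≤ ∑ _i : ι, ‖x‖ ^ 2 :=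
        Finset.sum_le_sum fun i _ => pow_le_pow_left₀ (norm_nonneg _) (norm_le_pi_norm x i) 2
    _ = Fintype.card ι * ‖x‖ ^ 2 := by simp

theorem norm2_le (x : ι → ℝ) : norm2 x ≤ Fintype.card ι * ‖x‖ := by
  refine le_of_sq_le_sq ?_ (by positivity)
  refine (norm2_sq_le x).trans ?_
  rw [mul_pow]
  refine mul_le_mul_of_nonneg_right ?_ (by positivity)
  exact_mod_cast Nat.le_self_pow two_ne_zero _

theorem continuous_norm2 : Continuous (norm2 : (ι → ℝ) → ℝ) :=
  (PiLp.continuous_toLp 2 _).norm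

theorem norm_stack {K q : ℕ} (w : Fin K → Fin q → ℝ) : ‖stack w‖ = ‖w‖ := by
  refine le_antisymm ?_ ?_
  · exact (pi_norm_le_iff_of_nonneg (norm_nonneg _)).2 fun i =>
      (norm_le_pi_norm (w i.1) i.2).trans (norm_le_pi_norm w i.1)
  · exact (pi_norm_le_iff_of_nonneg (norm_nonneg _)).2 fun k =>
      (pi_norm_le_iff_of_nonneg (norm_nonneg _)).2 fun j => norm_le_pi_norm (stack w) (k, j)

theorem continuous_stack {K q : ℕ} : Continuous (stack : (Fin K → Fin q → ℝ) → _) :=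
  continuous_pi fun _ => continuous_apply_apply _ _

end Norms

/-! ### Quadratic forms. -/

section QuadraticForms

variable {ι : Type*} [Fintype ι]

theorem continuous_wnormSq (M : Matrix ι ι ℝ) : Continuous (wnormSq M) := by
  unfold wnormSq
  fun_prop

theorem wnormSq_smul (M : Matrix ι ι ℝ) (r : ℝ) (x : ι → ℝ) :
    wnormSq M (r • x) = r ^ 2 * wnormSq M x := by
  simp only [wnormSq, Matrix.mulVec_smul, smul_dotProduct, dotProduct_smul, smul_eq_mul]
  ring

/-- The identity needs no symmetry of `M`. It is the quantitative form of strong convexity behind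
the final estimate. -/
theorem wnormSq_parallelogram (M : Matrix ι ι ℝ) (x y : ι → ℝ) :
    wnormSq M ((1 / 2 : ℝ) • (x + y)) =
      wnormSq M x / 2 + wnormSq M y / 2 - wnormSq M (x - y) / 4 := by
  rw [wnormSq_smul]
  simp only [wnormSq, Matrix.mulVec_add, Matrix.mulVec_sub, add_dotProduct, sub_dotProduct,
    dotProduct_add, dotProduct_sub]
  ring

theorem wnormSq_nonneg {M : Matrix ι ι ℝ} (hM : M.PosDef) (x : ι → ℝ) : 0 ≤ wnormSq M x := by
  simpa [wnormSq] using hM.posSemidef.dotProduct_mulVec_nonneg x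

/-- A positive definite quadratic form is bounded below by a multiple of the squared norm. -/
theorem exists_le_wnormSq {M : Matrix ι ι ℝ} (hM : M.PosDef) :
    ∃ l : ℝ, 0 < l ∧ ∀ x, l * ‖x‖ ^ 2 ≤ wnormSq M x := by
  -- The unit sphere is empty only in the zero space; otherwise the minimum over it is the constant.
  rcases (Metric.sphere (0 : ι → ℝ) 1).eq_empty_or_nonempty with h | h
  · refine ⟨1, one_pos, fun x => ?_⟩
    have hx : x = 0 := by
      by_contra hx
      have : (‖x‖⁻¹ • x) ∈ Metric.sphere (0 : ι → ℝ) 1 := by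
        simp [norm_smul, hx]
      simp [h] at this
    simp [hx, wnormSq]
  · obtain ⟨v, hv, hmin⟩ := (isCompact_sphere (0 : ι → ℝ) 1).exists_isMinOn h
      (continuous_wnormSq M).continuousOn
    have hv0 : v ≠ 0 := by
      rintro rfl
      simp at hv
    refine ⟨wnormSq M v, by simpa [wnormSq] using hM.dotProduct_mulVec_pos hv0, fun x => ?_⟩
    rcases eq_or_ne x 0 with rfl | hx
    · simp [wnormSq]
    · have hx' : (‖x‖⁻¹ • x) ∈ Metric.sphere (0 : ι → ℝ) 1 := by simp [norm_smul, hx]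
      have h1 : wnormSq M v ≤ wnormSq M (‖x‖⁻¹ • x) := hmin hx'
      have h2 : wnormSq M x = ‖x‖ ^ 2 * wnormSq M (‖x‖⁻¹ • x) := by
        rw [wnormSq_smul]
        have : ‖x‖ ≠ 0 := norm_ne_zero_iff.2 hx
        field_simp
      rw [h2, mul_comm]
      exact mul_le_mul_of_nonneg_left h1 (by positivity)

theorem exists_wnormSq_sub_le (M : Matrix ι ι ℝ) :
    ∃ K : ℝ, 0 ≤ K ∧ ∀ x y, wnormSq M x - wnormSq M y ≤ K * (‖x‖ + ‖y‖) * ‖x - y‖ := by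
  refine ⟨∑ i, ∑ j, |M i j|, by positivity, fun x y => ?_⟩
  have bil : ∀ v w : ι → ℝ, v ⬝ᵥ (M *ᵥ w) ≤ (∑ i, ∑ j, |M i j|) * (‖v‖ * ‖w‖) := by
    intro v w
    simp only [dotProduct, Matrix.mulVec, Finset.mul_sum, Finset.sum_mul]
    refine Finset.sum_le_sum fun i _ => Finset.sum_le_sum fun j _ => ?_
    calc v i * (M i j * w j) ≤ |v i * (M i j * w j)| := le_abs_self _
      _ = |M i j| * (‖v i‖ * ‖w j‖) := by
        rw [abs_mul, abs_mul, Real.norm_eq_abs, Real.norm_eq_abs]; ring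
      _ ≤ |M i j| * (‖v‖ * ‖w‖) := by
        gcongr
        · exact norm_le_pi_norm v i
        · exact norm_le_pi_norm w j
  have h1 := bil (x - y) x
  have h2 := bil y (x - y)
  have e : wnormSq M x - wnormSq M y = (x - y) ⬝ᵥ (M *ᵥ x) + y ⬝ᵥ (M *ᵥ (x - y)) := by
    simp only [wnormSq, Matrix.mulVec_sub, sub_dotProduct, dotProduct_sub]
    ring
  rw [e]
  linarith

end QuadraticForms

/-! ### The running cost. -/

section RunningCost

variable {n m p L : ℕ} {Q : Matrix (Fin p) (Fin p) ℝ} {R : Matrix (Fin m) (Fin m) ℝ}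

theorem runningCost_nonneg (hQ : Q.PosDef) (hR : R.PosDef) (u : Fin (n + L) → Fin m → ℝ)
    (y : Fin (n + L) → Fin p → ℝ) : 0 ≤ runningCost Q R u y :=
  Finset.sum_nonneg fun _ _ => add_nonneg (wnormSq_nonneg hR _) (wnormSq_nonneg hQ _)

theorem continuous_runningCost :
    Continuous fun z : (Fin (n + L) → Fin m → ℝ) × (Fin (n + L) → Fin p → ℝ) =>
      runningCost Q R z.1 z.2 := by
  unfold runningCost
  refine continuous_finsetSum _ fun k _ => ?_
  exact ((continuous_wnormSq R).comp ((continuous_apply _).comp continuous_fst)).add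
    ((continuous_wnormSq Q).comp ((continuous_apply _).comp continuous_snd))

theorem runningCost_parallelogram (u u' : Fin (n + L) → Fin m → ℝ)
    (y y' : Fin (n + L) → Fin p → ℝ) :
    runningCost Q R ((1 / 2 : ℝ) • (u + u')) ((1 / 2 : ℝ) • (y + y')) =
      runningCost Q R u y / 2 + runningCost Q R u' y' / 2 -
        runningCost Q R (u - u') (y - y') / 4 := by
  simp only [runningCost, Finset.sum_div, ← Finset.sum_add_distrib, ← Finset.sum_sub_distrib]
  refine Finset.sum_congr rfl fun k _ => ?_
  simp only [Pi.smul_apply, Pi.add_apply, Pi.sub_apply, wnormSq_parallelogram]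
  ring

theorem exists_le_runningCost (hQ : Q.PosDef) (hR : R.PosDef) :
    ∃ l : ℝ, 0 < l ∧ ∀ (u : Fin (n + L) → Fin m → ℝ) (y : Fin (n + L) → Fin p → ℝ) (k : Fin L),
      l * ‖u (Fin.natAdd n k)‖ ^ 2 ≤ runningCost Q R u y ∧
        l * ‖y (Fin.natAdd n k)‖ ^ 2 ≤ runningCost Q R u y := by
  obtain ⟨l₁, h₁, H₁⟩ := exists_le_wnormSq hR
  obtain ⟨l₂, h₂, H₂⟩ := exists_le_wnormSq hQ
  refine ⟨min l₁ l₂, lt_min h₁ h₂, fun u y k => ?_⟩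
  have h : wnormSq R (u (Fin.natAdd n k)) + wnormSq Q (y (Fin.natAdd n k)) ≤
      runningCost Q R u y :=
    Finset.single_le_sum (f := fun k : Fin L =>
      wnormSq R (u (Fin.natAdd n k)) + wnormSq Q (y (Fin.natAdd n k)))
      (fun _ _ => add_nonneg (wnormSq_nonneg hR _) (wnormSq_nonneg hQ _)) (Finset.mem_univ k)
  have hu := wnormSq_nonneg hR (u (Fin.natAdd n k))
  have hy := wnormSq_nonneg hQ (y (Fin.natAdd n k))
  have h3 := H₁ (u (Fin.natAdd n k))
  have h4 := H₂ (y (Fin.natAdd n k))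
  have h5 := mul_le_mul_of_nonneg_right (min_le_left l₁ l₂) (sq_nonneg ‖u (Fin.natAdd n k)‖)
  have h6 := mul_le_mul_of_nonneg_right (min_le_right l₁ l₂) (sq_nonneg ‖y (Fin.natAdd n k)‖)
  constructor <;> linarith

/-- The running cost is Lipschitz continuous on bounded sets. -/
theorem exists_runningCost_sub_le (Q : Matrix (Fin p) (Fin p) ℝ) (R : Matrix (Fin m) (Fin m) ℝ) :
    ∃ K : ℝ, 0 ≤ K ∧ ∀ (u u' : Fin (n + L) → Fin m → ℝ) (y y' : Fin (n + L) → Fin p → ℝ)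
      (b δ : ℝ), (∀ k : Fin L, ‖u (Fin.natAdd n k)‖ ≤ b) → (∀ k : Fin L, ‖u' (Fin.natAdd n k)‖ ≤ b) →
      (∀ k : Fin L, ‖y (Fin.natAdd n k)‖ ≤ b) → (∀ k : Fin L, ‖y' (Fin.natAdd n k)‖ ≤ b) →
      ‖u - u'‖ ≤ δ → (∀ k : Fin L, ‖y (Fin.natAdd n k) - y' (Fin.natAdd n k)‖ ≤ δ) →
      runningCost Q R u y - runningCost Q R u' y' ≤ K * b * δ := by
  obtain ⟨K₁, h₁, H₁⟩ := exists_wnormSq_sub_le R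
  obtain ⟨K₂, h₂, H₂⟩ := exists_wnormSq_sub_le Q
  refine ⟨L * ((K₁ + K₂) * 2), by positivity, fun u u' y y' b δ hu hu' hy hy' hδ hδ' => ?_⟩
  simp only [runningCost, ← Finset.sum_sub_distrib]
  calc ∑ k : Fin L, _ ≤ ∑ _k : Fin L, ((K₁ + K₂) * 2) * b * δ :=
        Finset.sum_le_sum fun k _ => ?_
    _ = _ := by simp; ring
  have hb : 0 ≤ b := (norm_nonneg _).trans (hu k)
  have hδ₀ : 0 ≤ δ := (norm_nonneg _).trans hδ
  have d := (norm_le_pi_norm (u - u') (Fin.natAdd n k)).trans hδ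
  have a1 := H₁ (u (Fin.natAdd n k)) (u' (Fin.natAdd n k))
  have a2 := H₂ (y (Fin.natAdd n k)) (y' (Fin.natAdd n k))
  have b1 : K₁ * (‖u (Fin.natAdd n k)‖ + ‖u' (Fin.natAdd n k)‖) *
      ‖u (Fin.natAdd n k) - u' (Fin.natAdd n k)‖ ≤ K₁ * (b + b) * δ := by
    gcongr
    · exact hu k
    · exact hu' k
    · exact d
  have b2 : K₂ * (‖y (Fin.natAdd n k)‖ + ‖y' (Fin.natAdd n k)‖) *
      ‖y (Fin.natAdd n k) - y' (Fin.natAdd n k)‖ ≤ K₂ * (b + b) * δ := by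
    gcongr
    · exact hy k
    · exact hy' k
    · exact hδ' k
  linarith

end RunningCost

/-! ### Sequences generated by Hankel matrices. -/

section Signal

variable {N q : ℕ}

/-- The sequence `H_K(w) α`, as a linear function of `α`. -/
def signal (K : ℕ) (w : Fin N → Fin q → ℝ) :
    (Fin (N + 1 - K) → ℝ) →ₗ[ℝ] (Fin K → Fin q → ℝ) where
  toFun α k j := (hankel K w *ᵥ α) (k, j)
  map_add' α α' := by ext k j; simp [Matrix.mulVec_add]
  map_smul' r α := by ext k j; simp [Matrix.mulVec_smul]

theorem stack_eq_hankel_iff {K : ℕ} {w : Fin N → Fin q → ℝ} {s : Fin K → Fin q → ℝ}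
    {α : Fin (N + 1 - K) → ℝ} : stack s = hankel K w *ᵥ α ↔ s = signal K w α := by
  refine ⟨fun h => ?_, fun h => ?_⟩
  · ext k j
    exact congrFun h (k, j)
  · subst h
    rfl

theorem signal_add {K : ℕ} (w w' : Fin N → Fin q → ℝ) (α : Fin (N + 1 - K) → ℝ) :
    signal K (w + w') α = signal K w α + signal K w' α := by
  ext k j
  simp [signal, hankel, Matrix.mulVec, dotProduct, add_mul, Finset.sum_add_distrib]

/-- Used with `w` the data noise: the prediction error is at most proportional to the noise level
times ‖α‖. The factor N + 1 - K counts the columns. -/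
theorem norm_signal_le {K : ℕ} {w : Fin N → Fin q → ℝ} {W : ℝ} (hW : 0 ≤ W) (h : ∀ k, ‖w k‖ ≤ W)
    (α : Fin (N + 1 - K) → ℝ) :
    ‖signal K w α‖ ≤ (N + 1 - K : ℕ) * W * ‖α‖ := by
  have h0 : 0 ≤ ((N + 1 - K : ℕ) : ℝ) * W * ‖α‖ := by positivity
  refine (pi_norm_le_iff_of_nonneg h0).2 fun k => (pi_norm_le_iff_of_nonneg h0).2 fun j => ?_
  change ‖∑ i, hankel K w (k, j) i * α i‖ ≤ _
  calc ‖∑ i, hankel K w (k, j) i * α i‖ ≤ ∑ i, ‖hankel K w (k, j) i * α i‖ := norm_sum_le _ _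
    _ ≤ ∑ _i : Fin (N + 1 - K), W * ‖α‖ := Finset.sum_le_sum fun i _ => by
        rw [norm_mul]
        refine mul_le_mul ?_ (norm_le_pi_norm α i) (norm_nonneg _) hW
        exact (norm_le_pi_norm (w ⟨k.val + i.val, by omega⟩) j).trans (h _)
    _ = _ := by simp; ring

theorem exists_norm_le_mul {F G : Type*} [NormedAddCommGroup F] [NormedSpace ℝ F]
    [FiniteDimensional ℝ F] [NormedAddCommGroup G] [NormedSpace ℝ G] (f : F →ₗ[ℝ] G) :
    ∃ C : ℝ, 0 ≤ C ∧ ∀ x, ‖f x‖ ≤ C * ‖x‖ :=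
  ⟨‖f.toContinuousLinearMap‖, norm_nonneg _, f.toContinuousLinearMap.le_opNorm⟩

end Signal

/-- A continuous function with a bounded sublevel set on a closed set attains its minimum. -/
theorem exists_minimizer_of_bounded_sublevel {E : Type*} [PseudoMetricSpace E] [ProperSpace E]
    {F : Set E} (hF : IsClosed F) {f : E → ℝ} (hf : Continuous f) {x₀ : E} (hx₀ : x₀ ∈ F)
    (hb : Bornology.IsBounded {x ∈ F | f x ≤ f x₀}) : ∃ x ∈ F, ∀ y ∈ F, f x ≤ f y := by
  have hc : IsCompact {x ∈ F | f x ≤ f x₀} :=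
    Metric.isCompact_of_isClosed_isBounded
      (hF.inter (isClosed_le hf continuous_const)) hb
  obtain ⟨x, hx, hmin⟩ := hc.exists_isMinOn ⟨x₀, hx₀, le_rfl⟩ hf.continuousOn
  refine ⟨x, hx.1, fun y hy => ?_⟩
  by_cases h : f y ≤ f x₀
  · exact hmin ⟨hy, h⟩
  · exact hx.2.trans (not_le.1 h).le

/-! ### Feasible sets as linear constraints on α. -/

section Feasibility

variable {n m p L N : ℕ}

/-- The samples of a sequence that the initial and terminal constraints prescribe. -/
def boundary (n L q : ℕ) :
    (Fin (n + L) → Fin q → ℝ) →ₗ[ℝ] (Fin n → Fin q → ℝ) × (Fin L → Fin q → ℝ) where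
  toFun s := (fun i => s (Fin.castAdd L i), fun k => if L ≤ k.val + n then s (Fin.natAdd n k) else 0)
  map_add' s s' := by
    ext <;> simp
    split_ifs <;> simp
  map_smul' r s := by
    ext <;> simp
    split_ifs <;> simp

/-- Samples that are not prescribed are sent to 0 and so impose nothing. All initial and terminal
conditions thereby become one linear equation, as Hoffman's bound requires. -/
theorem boundary_eq_iff {q : ℕ} {s : Fin (n + L) → Fin q → ℝ} {a : Fin n → Fin q → ℝ} :
    boundary n L q s = (a, 0) ↔
      (∀ i, s (Fin.castAdd L i) = a i) ∧ ∀ k : Fin L, L ≤ k.val + n → s (Fin.natAdd n k) = 0 := by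
  simp only [boundary, LinearMap.coe_mk, AddHom.coe_mk, Prod.mk.injEq, funext_iff (f := fun _ => _)]
  refine and_congr_right fun _ => forall_congr' fun k => ?_
  split_ifs with h <;> simp [h]

theorem norm_le_of_castAdd_of_natAdd {q : ℕ} {s : Fin (n + L) → Fin q → ℝ} {b : ℝ} (hb : 0 ≤ b)
    (h₁ : ∀ i, ‖s (Fin.castAdd L i)‖ ≤ b) (h₂ : ∀ k, ‖s (Fin.natAdd n k)‖ ≤ b) : ‖s‖ ≤ b :=
  (pi_norm_le_iff_of_nonneg hb).2 fun k => Fin.addCases h₁ h₂ k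

variable {U : Set (Fin m → ℝ)} {ud : Fin N → Fin m → ℝ} {yd : Fin N → Fin p → ℝ}
  {ξ : ExtState n m p}

theorem nominalFeasible_iff {z : NominalVar n m p L N} :
    NominalFeasible U Set.univ ud yd ξ z ↔
      z.u = signal (n + L) ud z.α ∧ z.y = signal (n + L) yd z.α ∧
        boundary n L m z.u = (ξ.u, 0) ∧ boundary n L p z.y = (ξ.y, 0) ∧
        ∀ k : Fin L, z.u (Fin.natAdd n k) ∈ U := by
  simp only [boundary_eq_iff]
  constructor
  · rintro ⟨h1, h2, h3, h4, h5⟩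
    exact ⟨stack_eq_hankel_iff.1 h1, stack_eq_hankel_iff.1 h2,
      ⟨fun i => (h3 i).1, fun k hk => (h5 k hk).1⟩, ⟨fun i => (h3 i).2, fun k hk => (h5 k hk).2⟩,
      fun k => (h4 k).1⟩
  · rintro ⟨h1, h2, h3, h4, h5⟩
    exact ⟨stack_eq_hankel_iff.2 h1, stack_eq_hankel_iff.2 h2, fun i => ⟨h3.1 i, h4.1 i⟩,
      fun k => ⟨h5 k, Set.mem_univ _⟩, fun k hk => ⟨h3.2 k hk, h4.2 k hk⟩⟩

theorem robustFeasible_iff {z : RobustVar n m p L N} :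
    RobustFeasible U ud yd ξ z ↔
      z.u = signal (n + L) ud z.α ∧ z.y + z.σ = signal (n + L) yd z.α ∧
        boundary n L m z.u = (ξ.u, 0) ∧ boundary n L p z.y = (ξ.y, 0) ∧
        ∀ k : Fin L, z.u (Fin.natAdd n k) ∈ U := by
  simp only [boundary_eq_iff]
  constructor
  · rintro ⟨h1, h2, h3, h4, h5⟩
    exact ⟨stack_eq_hankel_iff.1 h1, stack_eq_hankel_iff.1 h2,
      ⟨fun i => (h3 i).1, fun k hk => (h4 k hk).1⟩, ⟨fun i => (h3 i).2, fun k hk => (h4 k hk).2⟩,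
      h5⟩
  · rintro ⟨h1, h2, h3, h4, h5⟩
    exact ⟨stack_eq_hankel_iff.2 h1, stack_eq_hankel_iff.2 h2, fun i => ⟨h3.1 i, h4.1 i⟩,
      fun k hk => ⟨h3.2 k hk, h4.2 k hk⟩, h5⟩

/-- Feasible trajectories are generated by vectors `α` of comparable norm. -/
theorem exists_nominalFeasible_norm_le (U : Set (Fin m → ℝ)) (ud : Fin N → Fin m → ℝ)
    (yd : Fin N → Fin p → ℝ) :
    ∃ C : ℝ, 0 ≤ C ∧ ∀ (ξ : ExtState n m p) (z : NominalVar n m p L N),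
      NominalFeasible U Set.univ ud yd ξ z → ∀ b : ℝ, ‖z.u‖ ≤ b → ‖z.y‖ ≤ b →
        ∃ α, ‖α‖ ≤ C * b ∧ NominalFeasible U Set.univ ud yd ξ ⟨α, z.u, z.y⟩ := by
  -- Inputs and outputs are treated jointly, so the new α reproduces the whole trajectory, on which
  -- all other constraints depend.
  obtain ⟨C, hC, H⟩ := exists_preimage_norm_le
    ((signal (n + L) ud).prod (signal (n + L) yd))
  refine ⟨C, hC, fun ξ z hz b hu hy => ?_⟩
  obtain ⟨h1, h2, h3⟩ := nominalFeasible_iff.1 hz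
  obtain ⟨α, hα, hn⟩ := H z.α
  simp only [LinearMap.prod_apply, Function.prod_apply, Prod.mk.injEq, ← h1, ← h2] at hα hn
  refine ⟨α, hn.trans (mul_le_mul_of_nonneg_left (max_le hu hy) hC), ?_⟩
  exact nominalFeasible_iff.2 ⟨hα.1.symm, hα.2.symm, h3⟩

/-- Trajectories with bounded initial part and bounded cost are bounded. -/
theorem exists_norm_le_of_runningCost_le {Q : Matrix (Fin p) (Fin p) ℝ}
    {R : Matrix (Fin m) (Fin m) ℝ} (hQ : Q.PosDef) (hR : R.PosDef) (r c : ℝ) :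
    ∃ b : ℝ, 0 ≤ b ∧ ∀ (u : Fin (n + L) → Fin m → ℝ) (y : Fin (n + L) → Fin p → ℝ),
      runningCost Q R u y ≤ c → ((∀ i, ‖u (Fin.castAdd L i)‖ ≤ r) → ‖u‖ ≤ b) ∧
        ((∀ i, ‖y (Fin.castAdd L i)‖ ≤ r) → ‖y‖ ≤ b) := by
  obtain ⟨l, hl, H⟩ := exists_le_runningCost (n := n) (L := L) hQ hR
  have hb : 0 ≤ max r √(c / l) := le_max_of_le_right (Real.sqrt_nonneg _)
  have aux : ∀ x : ℝ, l * x ^ 2 ≤ c → x ≤ max r √(c / l) := fun x hx =>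
    le_max_of_le_right (Real.le_sqrt_of_sq_le ((le_div_iff₀' hl).2 hx))
  refine ⟨max r √(c / l), hb, fun u y hc => ⟨fun h => ?_, fun h => ?_⟩⟩
  · exact norm_le_of_castAdd_of_natAdd hb (fun i => le_max_of_le_left (h i))
      fun k => aux _ ((H u y k).1.trans hc)
  · exact norm_le_of_castAdd_of_natAdd hb (fun i => le_max_of_le_left (h i))
      fun k => aux _ ((H u y k).2.trans hc)

theorem NominalFeasible.norm_castAdd_le {z : NominalVar n m p L N}
    (hz : NominalFeasible U Set.univ ud yd ξ z) {r : ℝ} (hu : ‖ξ.u‖ ≤ r) (hy : ‖ξ.y‖ ≤ r)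
    (i : Fin n) : ‖z.u (Fin.castAdd L i)‖ ≤ r ∧ ‖z.y (Fin.castAdd L i)‖ ≤ r := by
  rw [(hz.initial i).1, (hz.initial i).2]
  exact ⟨(norm_le_pi_norm ξ.u i).trans hu, (norm_le_pi_norm ξ.y i).trans hy⟩

end Feasibility

/-! ### Existence of optimal solutions. -/

section Existence

variable {n m p L N : ℕ} {U : Set (Fin m → ℝ)} {ud : Fin N → Fin m → ℝ}
  {yd : Fin N → Fin p → ℝ} {ξ : ExtState n m p} {Q : Matrix (Fin p) (Fin p) ℝ}
  {R : Matrix (Fin m) (Fin m) ℝ}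

/-- The cost does not control α along the kernel of the Hankel matrices. Every trajectory no
costlier than `z₀` is however generated by some α with ‖α‖ ≤ C * b, so minimizing over this compact
part suffices. -/
theorem exists_nominalOptimal (hU : IsClosed U) (hQ : Q.PosDef) (hR : R.PosDef)
    {z₀ : NominalVar n m p L N} (hz₀ : NominalFeasible U Set.univ ud yd ξ z₀) :
    ∃ z : NominalVar n m p L N, NominalOptimal Q R U Set.univ ud yd ξ z := by
  obtain ⟨C, hC, H⟩ := exists_nominalFeasible_norm_le (n := n) (L := L) U ud yd
  obtain ⟨b, hb, Hb⟩ := exists_norm_le_of_runningCost_le (n := n) (L := L) hQ hR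
    (max ‖ξ.u‖ ‖ξ.y‖) (runningCost Q R z₀.u z₀.y)
  have bounded : ∀ z : NominalVar n m p L N, NominalFeasible U Set.univ ud yd ξ z →
      runningCost Q R z.u z.y ≤ runningCost Q R z₀.u z₀.y →
        ∃ α, ‖α‖ ≤ C * b ∧ NominalFeasible U Set.univ ud yd ξ ⟨α, z.u, z.y⟩ := by
    intro z hz hc
    have hi := hz.norm_castAdd_le (le_max_left ‖ξ.u‖ ‖ξ.y‖) (le_max_right ‖ξ.u‖ ‖ξ.y‖)
    exact H ξ z hz b ((Hb _ _ hc).1 fun i => (hi i).1) ((Hb _ _ hc).2 fun i => (hi i).2)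
  have cu : Continuous (signal (n + L) ud) := LinearMap.continuous_of_finiteDimensional _
  have cy : Continuous (signal (n + L) yd) := LinearMap.continuous_of_finiteDimensional _
  have cbu : Continuous (boundary n L m) := LinearMap.continuous_of_finiteDimensional _
  have cby : Continuous (boundary n L p) := LinearMap.continuous_of_finiteDimensional _
  let F : Set (Fin (N + 1 - (n + L)) → ℝ) := {α | ‖α‖ ≤ C * b} ∩
    ({α | boundary n L m (signal (n + L) ud α) = (ξ.u, 0)} ∩
    ({α | boundary n L p (signal (n + L) yd α) = (ξ.y, 0)} ∩
      ⋂ k : Fin L, {α | signal (n + L) ud α (Fin.natAdd n k) ∈ U}))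
  have hF : IsClosed F := by
    refine (isClosed_le continuous_norm continuous_const).inter
      ((isClosed_eq (cbu.comp cu) continuous_const).inter
      ((isClosed_eq (cby.comp cy) continuous_const).inter (isClosed_iInter fun k => ?_)))
    exact hU.preimage ((continuous_apply _).comp cu)
  have mem : ∀ {α u y}, ‖α‖ ≤ C * b → NominalFeasible U Set.univ ud yd ξ ⟨α, u, y⟩ → α ∈ F := by
    intro α u y hα hz
    obtain ⟨h1, h2, h⟩ := nominalFeasible_iff.1 hz
    dsimp only at h1 h2 h
    subst h1 h2
    exact ⟨hα, h.1, h.2.1, Set.mem_iInter.2 h.2.2⟩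
  obtain ⟨α₀, hα₀, hf₀⟩ := bounded z₀ hz₀ le_rfl
  let f : (Fin (N + 1 - (n + L)) → ℝ) → ℝ := fun α =>
    runningCost Q R (signal (n + L) ud α) (signal (n + L) yd α)
  have hf : Continuous f := continuous_runningCost.comp (cu.prodMk cy)
  have hbd : Bornology.IsBounded {α ∈ F | f α ≤ f α₀} :=
    (Metric.isBounded_closedBall (x := (0 : Fin (N + 1 - (n + L)) → ℝ)) (r := C * b)).subset
      fun α hα => by simpa using hα.1.1
  obtain ⟨α, hα, hmin⟩ := exists_minimizer_of_bounded_sublevel hF hf (mem hα₀ hf₀) hbd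
  have val : ∀ {α u y}, NominalFeasible U Set.univ ud yd ξ ⟨α, u, y⟩ →
      f α = runningCost Q R u y := by
    intro α u y hz
    obtain ⟨h1, h2, h⟩ := nominalFeasible_iff.1 hz
    dsimp only at h1 h2 h
    subst h1 h2
    rfl
  refine ⟨⟨α, signal (n + L) ud α, signal (n + L) yd α⟩,
    nominalFeasible_iff.2 ⟨rfl, rfl, hα.2.1, hα.2.2.1, Set.mem_iInter.1 hα.2.2.2⟩,
    fun z hz => ?_⟩
  change f α ≤ _
  by_cases hc : runningCost Q R z.u z.y ≤ runningCost Q R z₀.u z₀.y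
  · obtain ⟨α', hα', hz'⟩ := bounded z hz hc
    rw [← val hz']
    exact hmin _ (mem hα' hz')
  · refine le_trans ?_ (not_le.1 hc).le
    rw [← val hf₀]
    exact hmin _ (mem hα₀ hf₀)

/-- The pair (α, σ) determines u and y, and the two regularization terms make the cost coercive in
it. -/
theorem exists_robustOptimal (hU : IsClosed U) (hQ : Q.PosDef) (hR : R.PosDef) (reg : RegParams)
    {ε : ℝ} (hε : 0 < ε) {z₀ : RobustVar n m p L N} (hz₀ : RobustFeasible U ud yd ξ z₀) :
    ∃ z : RobustVar n m p L N, RobustOptimal Q R U reg ε ud yd ξ z := by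
  have cu : Continuous (signal (n + L) ud) := LinearMap.continuous_of_finiteDimensional _
  have cy : Continuous (signal (n + L) yd) := LinearMap.continuous_of_finiteDimensional _
  have cbu : Continuous (boundary n L m) := LinearMap.continuous_of_finiteDimensional _
  have cby : Continuous (boundary n L p) := LinearMap.continuous_of_finiteDimensional _
  let X := (Fin (N + 1 - (n + L)) → ℝ) × (Fin (n + L) → Fin p → ℝ)
  let toVar : X → RobustVar n m p L N := fun x =>
    ⟨x.1, x.2, signal (n + L) ud x.1, signal (n + L) yd x.1 - x.2⟩
  have toVar_eq : ∀ z, RobustFeasible U ud yd ξ z → z = toVar (z.α, z.σ) := by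
    rintro ⟨α, σ, u, y⟩ hz
    obtain ⟨h1, h2, -⟩ := robustFeasible_iff.1 hz
    simp only at h1 h2
    simp only [toVar, ← h1, ← h2, add_sub_cancel_right]
  let F : Set X := {x | boundary n L m (toVar x).u = (ξ.u, 0)} ∩
    ({x | boundary n L p (toVar x).y = (ξ.y, 0)} ∩
      ⋂ k : Fin L, {x | (toVar x).u (Fin.natAdd n k) ∈ U})
  have cu' : Continuous fun x => (toVar x).u := cu.comp continuous_fst
  have cy' : Continuous fun x => (toVar x).y := (cy.comp continuous_fst).sub continuous_snd
  have hF : IsClosed F := by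
    refine (isClosed_eq (cbu.comp cu') continuous_const).inter
      ((isClosed_eq (cby.comp cy') continuous_const).inter (isClosed_iInter fun k => ?_))
    exact hU.preimage ((continuous_apply _).comp cu')
  have mem_iff : ∀ x, x ∈ F ↔ RobustFeasible U ud yd ξ (toVar x) := by
    intro x
    rw [robustFeasible_iff]
    simp [F, toVar]
  let f : X → ℝ := fun x => robustCost Q R reg ε (toVar x)
  have hf : Continuous f :=
    ((continuous_runningCost.comp (cu'.prodMk cy')).add
      (continuous_const.mul ((continuous_norm2.comp continuous_fst).pow 2))).add
      (continuous_const.mul ((continuous_norm2.comp (continuous_stack.comp continuous_snd)).pow 2))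
  have h₀ : (z₀.α, z₀.σ) ∈ F := (mem_iff _).2 (toVar_eq z₀ hz₀ ▸ hz₀)
  have hbd : Bornology.IsBounded {x ∈ F | f x ≤ f (z₀.α, z₀.σ)} := by
    let c := f (z₀.α, z₀.σ)
    let a₁ := reg.lamα * ε ^ reg.βα
    let a₂ := reg.lamσ / ε ^ reg.βσ
    have ha₁ : 0 < a₁ := mul_pos reg.lamα_pos (Real.rpow_pos_of_pos hε _)
    have ha₂ : 0 < a₂ := div_pos reg.lamσ_pos (Real.rpow_pos_of_pos hε _)
    refine (Metric.isBounded_closedBall (x := (0 : X)) (r := max √(c / a₁) √(c / a₂))).subset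
      fun x hx => ?_
    have h1 : runningCost Q R (toVar x).u (toVar x).y + a₁ * norm2 x.1 ^ 2
      + a₂ * norm2 (stack x.2) ^ 2 ≤ c := hx.2
    have h2 := runningCost_nonneg hQ hR (toVar x).u (toVar x).y
    have h3 : 0 ≤ a₁ * norm2 x.1 ^ 2 := by positivity
    have h4 : 0 ≤ a₂ * norm2 (stack x.2) ^ 2 := by positivity
    rw [mem_closedBall_zero_iff]
    refine max_le_max ?_ ?_
    · refine (norm_le_norm2 _).trans (Real.le_sqrt_of_sq_le ((le_div_iff₀' ha₁).2 ?_))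
      linarith
    · rw [← norm_stack]
      refine (norm_le_norm2 _).trans (Real.le_sqrt_of_sq_le ((le_div_iff₀' ha₂).2 ?_))
      linarith
  obtain ⟨x, hx, hmin⟩ := exists_minimizer_of_bounded_sublevel hF hf h₀ hbd
  refine ⟨toVar x, (mem_iff x).1 hx, fun z hz => ?_⟩
  rw [toVar_eq z hz]
  exact hmin _ ((mem_iff _).2 (toVar_eq z hz ▸ hz))

/-- What a bound on the Lyapunov function says about the nominal problem. -/
theorem exists_of_lyapunov_le {P : Matrix ((Fin n × Fin m) ⊕ (Fin n × Fin p))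
    ((Fin n × Fin m) ⊕ (Fin n × Fin p)) ℝ} (hQ : Q.PosDef) (hR : R.PosDef) (hP : P.PosDef)
    {c V : ℝ} (hc : 0 < c) (h : lyapunov L Q R U Set.univ ud yd P c ξ ≤ (V : EReal)) :
    (∃ z : NominalVar n m p L N, NominalFeasible U Set.univ ud yd ξ z ∧
      runningCost Q R z.u z.y ≤ V + 1) ∧ wnormSq P ξ.vec ≤ c * V := by
  have hw : 0 ≤ 1 / c * wnormSq P ξ.vec := mul_nonneg (by positivity) (wnormSq_nonneg hP _)
  have hJ : 0 ≤ nominalValue L Q R U Set.univ ud yd ξ :=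
    le_iInf₂ fun z _ => EReal.coe_nonneg.2 (runningCost_nonneg hQ hR _ _)
  unfold lyapunov at h
  constructor
  -- The slack 1 makes the inequality strict, so a finite infimum yields a feasible point before
  -- attainment is known.
  · have h1 : nominalValue L Q R U Set.univ ud yd ξ < ((V + 1 : ℝ) : EReal) := by
      have h2 : nominalValue L Q R U Set.univ ud yd ξ ≤
          nominalValue L Q R U Set.univ ud yd ξ + ((1 / c * wnormSq P ξ.vec : ℝ) : EReal) :=
        le_add_of_nonneg_right (EReal.coe_nonneg.2 hw)
      exact (h2.trans h).trans_lt (EReal.coe_lt_coe_iff.2 (by linarith))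
    obtain ⟨z, hz⟩ := iInf_lt_iff.1 h1
    obtain ⟨hz, hlt⟩ := iInf_lt_iff.1 hz
    exact ⟨z, hz, (EReal.coe_lt_coe_iff.1 hlt).le⟩
  · have h2 : ((1 / c * wnormSq P ξ.vec : ℝ) : EReal) ≤ (V : EReal) :=
      (le_add_of_nonneg_left hJ).trans h
    have h3 := EReal.coe_le_coe_iff.1 h2
    rw [one_div, inv_mul_le_iff₀ hc] at h3
    exact h3

end Existence

/-! ### Comparison of the robust and the nominal problem. -/

section Estimates

variable {n m p L N : ℕ} {U : Set (Fin m → ℝ)}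

theorem IsPolytope.exists_norm_le (hU : IsPolytope U) : ∃ b : ℝ, 0 ≤ b ∧ ∀ v ∈ U, ‖v‖ ≤ b := by
  obtain ⟨b, hb⟩ := hU.1.isBounded.exists_norm_le
  exact ⟨max b 0, le_max_right _ _, fun v hv => (hb v hv).trans (le_max_left _ _)⟩

theorem IsPolytope.convex (hU : IsPolytope U) : Convex ℝ U := by
  obtain ⟨-, r, G, g, rfl⟩ := hU
  exact (convex_Iic g).linear_preimage (Matrix.mulVecLin G)

theorem ExtState.norm_le {ξ : ExtState n m p} {b : ℝ} (h : ‖ξ.vec‖ ≤ b) : ‖ξ.u‖ ≤ b ∧ ‖ξ.y‖ ≤ b := by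
  have hb : 0 ≤ b := (norm_nonneg _).trans h
  rw [← norm_stack, ← norm_stack]
  exact ⟨(pi_norm_le_iff_of_nonneg hb).2 fun i => (norm_le_pi_norm ξ.vec (Sum.inl i)).trans h,
    (pi_norm_le_iff_of_nonneg hb).2 fun i => (norm_le_pi_norm ξ.vec (Sum.inr i)).trans h⟩

theorem norm_boundary_le {q : ℕ} (s : Fin (n + L) → Fin q → ℝ) : ‖boundary n L q s‖ ≤ ‖s‖ := by
  refine max_le ((pi_norm_le_iff_of_nonneg (norm_nonneg _)).2 fun i => norm_le_pi_norm s _)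
    ((pi_norm_le_iff_of_nonneg (norm_nonneg _)).2 fun k => ?_)
  change ‖if L ≤ k.val + n then s (Fin.natAdd n k) else 0‖ ≤ ‖s‖
  split_ifs
  · exact norm_le_pi_norm s _
  · simp

/-- A feasible point of the robust problem is close to the feasible set of the nominal problem. -/
theorem exists_nominalFeasible_near (hU : IsPolytope U) (ud : Fin N → Fin m → ℝ)
    (yd : Fin N → Fin p → ℝ) :
    ∃ C : ℝ, 0 ≤ C ∧ ∀ (ξ : ExtState n m p) (z₀ : NominalVar n m p L N),
      NominalFeasible U Set.univ ud yd ξ z₀ →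
      ∀ (yd' : Fin N → Fin p → ℝ) (ν : Fin n → Fin p → ℝ) (z : RobustVar n m p L N),
        RobustFeasible U ud yd' (ξ.addNoise ν) z →
        ∀ δ, ‖signal (n + L) yd z.α - z.y‖ ≤ δ → ‖ν‖ ≤ δ →
        ∃ z' : NominalVar n m p L N, NominalFeasible U Set.univ ud yd ξ z' ∧
          ‖z'.u - z.u‖ ≤ C * δ ∧ ‖z'.y - z.y‖ ≤ C * δ := by
  obtain ⟨-, r, G, g, rfl⟩ := hU
  let A : (Fin (N + 1 - (n + L)) → ℝ) →ₗ[ℝ] (Fin L × Fin r → ℝ) := LinearMap.pi fun i =>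
    LinearMap.proj i.2 ∘ₗ G.mulVecLin ∘ₗ LinearMap.proj (Fin.natAdd n i.1) ∘ₗ signal (n + L) ud
  let E := (boundary n L m ∘ₗ signal (n + L) ud).prod (boundary n L p ∘ₗ signal (n + L) yd)
  obtain ⟨C, hC, H⟩ := hoffman A E
  obtain ⟨Cu, hCu, Hu⟩ := exists_norm_le_mul (signal (n + L) ud)
  obtain ⟨Cy, hCy, Hy⟩ := exists_norm_le_mul (signal (n + L) yd)
  have hA : ∀ α, A α ≤ (fun i => g i.2) ↔
      ∀ k : Fin L, signal (n + L) ud α (Fin.natAdd n k) ∈ {v | G *ᵥ v ≤ g} :=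
    fun α => ⟨fun h k i => h (k, i), fun h i => h i.1 i.2⟩
  refine ⟨Cu * (C * 2) + (Cy * (C * 2) + 1), by positivity,
    fun ξ z₀ hz₀ yd' ν z hz δ hδ hν => ?_⟩
  have hδ₀ : 0 ≤ δ := (norm_nonneg _).trans hν
  obtain ⟨a1, a2, a3, a4, a5⟩ := nominalFeasible_iff.1 hz₀
  obtain ⟨b1, -, b3, b4, b5⟩ := robustFeasible_iff.1 hz
  rw [a1] at a3 a5
  rw [a2] at a4
  -- The input data are noise-free, so α̂ satisfies the input inequalities exactly; only the
  -- equations of `E` can fail.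
  obtain ⟨α, h1, h2, h3⟩ := H (fun i => g i.2) ((ξ.u, 0), (ξ.y, 0)) z₀.α ((hA _).2 a5)
    (Prod.ext a3 a4) z.α ((hA _).2 (b1 ▸ b5))
  -- The input equations hold exactly. The output equations fail by the prediction mismatch plus the
  -- initial noise ν, each at most δ.
  have hE : ‖E z.α - ((ξ.u, 0), (ξ.y, 0))‖ ≤ 2 * δ := by
    refine max_le ?_ ?_
    · change ‖boundary n L m (signal (n + L) ud z.α) - (ξ.u, 0)‖ ≤ 2 * δ
      rw [← b1, b3]
      simpa [ExtState.addNoise] using hδ₀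
    · change ‖boundary n L p (signal (n + L) yd z.α) - (ξ.y, 0)‖ ≤ 2 * δ
      have e : boundary n L p (signal (n + L) yd z.α) - (ξ.y, 0) =
          boundary n L p (signal (n + L) yd z.α - z.y) + (ν, 0) := by
        rw [map_sub, b4]
        ext <;> simp [ExtState.addNoise]
        ring
      rw [e, two_mul]
      refine (norm_add_le _ _).trans (add_le_add ((norm_boundary_le _).trans hδ) ?_)
      simpa using hν
  have h4 : ‖α - z.α‖ ≤ C * 2 * δ := by
    rw [mul_assoc]
    exact h3.trans (mul_le_mul_of_nonneg_left hE hC)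
  have p1 : 0 ≤ Cu * (C * 2) * δ := by positivity
  have p2 : 0 ≤ Cy * (C * 2) * δ := by positivity
  refine ⟨⟨α, signal (n + L) ud α, signal (n + L) yd α⟩, nominalFeasible_iff.2
    ⟨rfl, rfl, congrArg Prod.fst h2, congrArg Prod.snd h2, (hA _).1 h1⟩, ?_, ?_⟩
  · have h5 := (Hu (α - z.α)).trans (mul_le_mul_of_nonneg_left h4 hCu)
    rw [map_sub, ← b1] at h5
    refine h5.trans ?_
    linarith
  · have h5 := (Hy (α - z.α)).trans (mul_le_mul_of_nonneg_left h4 hCy)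
    rw [map_sub] at h5
    have h6 := norm_add_le (signal (n + L) yd α - signal (n + L) yd z.α)
      (signal (n + L) yd z.α - z.y)
    rw [sub_add_sub_cancel] at h6
    refine h6.trans ?_
    linarith

/-- A nominally feasible point extends to a feasible point of the robust problem. -/
theorem robustFeasible_of_nominalFeasible {ud : Fin N → Fin m → ℝ} {yd : Fin N → Fin p → ℝ}
    {ξ : ExtState n m p} {z : NominalVar n m p L N} (hz : NominalFeasible U Set.univ ud yd ξ z)
    (εd : Fin N → Fin p → ℝ) (ν : Fin n → Fin p → ℝ) :
    RobustFeasible U ud (yd + εd) (ξ.addNoise ν)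
      ⟨z.α, signal (n + L) εd z.α - Fin.append ν 0, z.u, z.y + Fin.append ν 0⟩ := by
  -- `Fin.append ν 0` is the noise on the past outputs, with zeros at the predicted times. It is
  -- added to y and subtracted in the slack, which also carries the data noise.
  obtain ⟨h1, h2, h3, h4, h5⟩ := nominalFeasible_iff.1 hz
  refine robustFeasible_iff.2 ⟨h1, ?_, h3, ?_, h5⟩
  · dsimp only
    rw [signal_add, ← h2]
    abel
  · have : boundary n L p (Fin.append ν 0) = (ν, 0) := boundary_eq_iff.2 ⟨by simp, by simp⟩
    dsimp only
    rw [map_add, h4, this]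
    ext <;> simp [ExtState.addNoise]

theorem runningCost_add_append (Q : Matrix (Fin p) (Fin p) ℝ) (R : Matrix (Fin m) (Fin m) ℝ)
    (u : Fin (n + L) → Fin m → ℝ) (y : Fin (n + L) → Fin p → ℝ) (ν : Fin n → Fin p → ℝ) :
    runningCost Q R u (y + Fin.append ν 0) = runningCost Q R u y := by
  simp [runningCost]

/-- The optimal cost of the robust problem exceeds the nominal cost by a small amount. -/
theorem exists_robustCost_le {Q : Matrix (Fin p) (Fin p) ℝ} {R : Matrix (Fin m) (Fin m) ℝ}
    (ud : Fin N → Fin m → ℝ) (yd : Fin N → Fin p → ℝ) (reg : RegParams) {g : ℝ}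
    (hg₁ : g ≤ reg.βα) (hg₂ : g ≤ 2 - reg.βσ) (b : ℝ) :
    ∃ C : ℝ, 0 ≤ C ∧ ∀ ε : ℝ, 0 < ε → ε ≤ 1 →
      ∀ εd : Fin N → Fin p → ℝ, (∀ k, ‖εd k‖ ≤ ε) → ∀ ν : Fin n → Fin p → ℝ, ‖ν‖ ≤ ε →
      ∀ (ξ : ExtState n m p) (z : NominalVar n m p L N),
        NominalFeasible U Set.univ ud yd ξ z → ‖z.u‖ ≤ b → ‖z.y‖ ≤ b →
        ∃ z' : RobustVar n m p L N, RobustFeasible U ud (yd + εd) (ξ.addNoise ν) z' ∧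
          robustCost Q R reg ε z' ≤ runningCost Q R z.u z.y + C * ε ^ g := by
  obtain ⟨C, hC, H⟩ := exists_nominalFeasible_norm_le (n := n) (L := L) U ud yd
  let M : ℝ := (N + 1 - (n + L) : ℕ)
  have hM : 0 ≤ M := Nat.cast_nonneg _
  let D : ℝ := Fintype.card (Fin (n + L) × Fin p)
  have hD : 0 ≤ D := Nat.cast_nonneg _
  have hlα := reg.lamα_pos
  have hlσ := reg.lamσ_pos
  -- The first term comes from ‖α‖ ≤ C * b. The second comes from a slack of size (M * (C * b) + 1)
  -- * ε, whose weight 1 / ε^βσ leaves the power 2 - βσ.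
  refine ⟨reg.lamα * (M * (C * b) ^ 2) + reg.lamσ * (D * (M * (C * b) + 1) ^ 2), by positivity,
    fun ε hε hε1 εd hεd ν hν ξ z hz hu hy => ?_⟩
  obtain ⟨α, hα, hz'⟩ := H ξ z hz b hu hy
  refine ⟨_, robustFeasible_of_nominalFeasible hz' εd ν, ?_⟩
  simp only [robustCost, runningCost_add_append]
  have hν' : ‖(Fin.append ν 0 : Fin (n + L) → Fin p → ℝ)‖ ≤ ε :=
    norm_le_of_castAdd_of_natAdd hε.le
      (fun i => by simpa using (norm_le_pi_norm ν i).trans hν) (fun k => by simpa using hε.le)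
  have hσ : ‖signal (n + L) εd α - Fin.append ν 0‖ ≤ (M * (C * b) + 1) * ε := by
    refine (norm_sub_le _ _).trans ?_
    have h1 := norm_signal_le hε.le hεd α
    have h2 : M * ε * ‖α‖ ≤ M * ε * (C * b) := mul_le_mul_of_nonneg_left hα (by positivity)
    linarith
  have h1 : norm2 α ^ 2 ≤ M * (C * b) ^ 2 := by
    refine (norm2_sq_le α).trans ?_
    simp only [Fintype.card_fin]
    exact mul_le_mul_of_nonneg_left (pow_le_pow_left₀ (norm_nonneg _) hα 2) hM
  have h2 : norm2 (stack (signal (n + L) εd α - Fin.append ν 0)) ^ 2 ≤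
      D * (M * (C * b) + 1) ^ 2 * ε ^ 2 := by
    refine (norm2_sq_le _).trans ?_
    rw [norm_stack, mul_assoc, ← mul_pow]
    exact mul_le_mul_of_nonneg_left (pow_le_pow_left₀ (norm_nonneg _) hσ 2) hD
  have e1 : ε ^ reg.βα ≤ ε ^ g := Real.rpow_le_rpow_of_exponent_ge hε hε1 hg₁
  have e2 : ε ^ 2 / ε ^ reg.βσ ≤ ε ^ g := by
    rw [← Real.rpow_two, ← Real.rpow_sub hε]
    exact Real.rpow_le_rpow_of_exponent_ge hε hε1 hg₂
  have hp : 0 < ε ^ reg.βσ := Real.rpow_pos_of_pos hε _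
  have t1 : reg.lamα * ε ^ reg.βα * norm2 α ^ 2 ≤ reg.lamα * ε ^ g * (M * (C * b) ^ 2) := by
    gcongr
  have t2 : reg.lamσ / ε ^ reg.βσ * norm2 (stack (signal (n + L) εd α - Fin.append ν 0)) ^ 2 ≤
      reg.lamσ * (D * (M * (C * b) + 1) ^ 2) * ε ^ g := by
    calc _ ≤ reg.lamσ / ε ^ reg.βσ * (D * (M * (C * b) + 1) ^ 2 * ε ^ 2) := by gcongr
      _ = reg.lamσ * (D * (M * (C * b) + 1) ^ 2) * (ε ^ 2 / ε ^ reg.βσ) := by ring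
      _ ≤ _ := by gcongr
  linarith

/-- Turns a bound on a weighted square into a bound on the variable. The exponent may have either
sign: βα for α, -βσ for the slack, -g in the final estimate. -/
theorem le_sqrt_mul_rpow {l ε β x V : ℝ} (hl : 0 < l) (hε : 0 < ε) (h : l * ε ^ β * x ^ 2 ≤ V) :
    x ≤ √(V / l) * ε ^ (-β / 2) := by
  have hp : 0 < ε ^ β := Real.rpow_pos_of_pos hε _
  have e : ε ^ (-β / 2) = √((ε ^ β)⁻¹) := by
    rw [Real.sqrt_eq_rpow, ← Real.rpow_neg hε.le, ← Real.rpow_mul hε.le]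
    ring_nf
  rw [e, ← Real.sqrt_mul' _ (by positivity)]
  refine Real.le_sqrt_of_sq_le ?_
  rw [div_mul_eq_mul_div, le_div_iff₀ hl, ← div_eq_mul_inv, le_div_iff₀ hp]
  linarith

/-- Points of bounded robust cost nearly satisfy the noise-free dynamics. -/
theorem exists_norm_signal_sub_le {Q : Matrix (Fin p) (Fin p) ℝ} {R : Matrix (Fin m) (Fin m) ℝ}
    (hQ : Q.PosDef) (hR : R.PosDef) (ud : Fin N → Fin m → ℝ) (yd : Fin N → Fin p → ℝ)
    (reg : RegParams) {g : ℝ} (hg₁ : g ≤ reg.βσ / 2) (hg₂ : g ≤ 1 - reg.βα / 2) (V : ℝ) :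
    ∃ C : ℝ, 0 ≤ C ∧ ∀ ε : ℝ, 0 < ε → ε ≤ 1 →
      ∀ εd : Fin N → Fin p → ℝ, (∀ k, ‖εd k‖ ≤ ε) →
      ∀ (ξ : ExtState n m p) (z : RobustVar n m p L N),
        RobustFeasible U ud (yd + εd) ξ z → robustCost Q R reg ε z ≤ V →
          ‖signal (n + L) yd z.α - z.y‖ ≤ C * ε ^ g := by
  let M : ℝ := (N + 1 - (n + L) : ℕ)
  have hM : 0 ≤ M := Nat.cast_nonneg _
  have hlα := reg.lamα_pos
  have hlσ := reg.lamσ_pos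
  refine ⟨√(V / reg.lamσ) + M * √(V / reg.lamα), by positivity,
    fun ε hε hε1 εd hεd ξ z hz hc => ?_⟩
  obtain ⟨-, h2, -⟩ := robustFeasible_iff.1 hz
  unfold robustCost at hc
  have c1 := runningCost_nonneg hQ hR z.u z.y
  have p1 : 0 < ε ^ reg.βα := Real.rpow_pos_of_pos hε _
  have p2 : 0 < ε ^ reg.βσ := Real.rpow_pos_of_pos hε _
  have c2 : 0 ≤ reg.lamα * ε ^ reg.βα * norm2 z.α ^ 2 := by positivity
  have c3 : 0 ≤ reg.lamσ / ε ^ reg.βσ * norm2 (stack z.σ) ^ 2 := by positivity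
  have hα : ‖z.α‖ ≤ √(V / reg.lamα) * ε ^ (-reg.βα / 2) :=
    (norm_le_norm2 _).trans (le_sqrt_mul_rpow hlα hε (by linarith))
  have hσ : ‖z.σ‖ ≤ √(V / reg.lamσ) * ε ^ (- -reg.βσ / 2) := by
    rw [← norm_stack]
    refine (norm_le_norm2 _).trans (le_sqrt_mul_rpow hlσ hε ?_)
    rw [Real.rpow_neg hε.le, ← div_eq_mul_inv]
    linarith
  -- The noisy prediction equation leaves two errors: the slack, of order ε^(βσ/2), and the data
  -- noise times α̂, of order ε * ε^(-βα/2).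
  have e : signal (n + L) yd z.α - z.y = z.σ - signal (n + L) εd z.α := by
    rw [signal_add] at h2
    rw [sub_eq_sub_iff_add_eq_add, ← h2]
    exact add_comm _ _
  have e1 : ε ^ (- -reg.βσ / 2) ≤ ε ^ g :=
    Real.rpow_le_rpow_of_exponent_ge hε hε1 (by rwa [neg_neg])
  have e2 : ε * ε ^ (-reg.βα / 2) ≤ ε ^ g := by
    have h : ε * ε ^ (-reg.βα / 2) = ε ^ (1 + -reg.βα / 2) := by
      rw [Real.rpow_add hε, Real.rpow_one]
    rw [h]
    exact Real.rpow_le_rpow_of_exponent_ge hε hε1 (by linarith)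
  rw [e]
  refine (norm_sub_le _ _).trans ?_
  have h5 : M * ε * ‖z.α‖ ≤ M * √(V / reg.lamα) * ε ^ g := by
    calc M * ε * ‖z.α‖ ≤ M * ε * (√(V / reg.lamα) * ε ^ (-reg.βα / 2)) := by gcongr
      _ = M * √(V / reg.lamα) * (ε * ε ^ (-reg.βα / 2)) := by ring
      _ ≤ _ := by gcongr
  have h6 : √(V / reg.lamσ) * ε ^ (- -reg.βσ / 2) ≤ √(V / reg.lamσ) * ε ^ g := by gcongr
  have h7 := norm_signal_le hε.le hεd z.α
  linarith

end Estimates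

/-! ### The Hölder estimate for the optimal input. -/

section Rate

variable {n m p L N : ℕ} {U : Set (Fin m → ℝ)}

theorem NominalFeasible.midpoint (hU : Convex ℝ U) {ud : Fin N → Fin m → ℝ}
    {yd : Fin N → Fin p → ℝ} {ξ : ExtState n m p} {z z' : NominalVar n m p L N}
    (hz : NominalFeasible U Set.univ ud yd ξ z) (hz' : NominalFeasible U Set.univ ud yd ξ z') :
    NominalFeasible U Set.univ ud yd ξ
      (⟨(1 / 2 : ℝ) • (z.α + z'.α), (1 / 2 : ℝ) • (z.u + z'.u), (1 / 2 : ℝ) • (z.y + z'.y)⟩ :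
        NominalVar n m p L N) := by
  obtain ⟨a1, a2, a3, a4, a5⟩ := nominalFeasible_iff.1 hz
  obtain ⟨b1, b2, b3, b4, b5⟩ := nominalFeasible_iff.1 hz'
  have half : ∀ {E : Type} [AddCommGroup E] [Module ℝ E] (x : E), (1 / 2 : ℝ) • (x + x) = x := by
    intro E _ _ x
    rw [← two_smul ℝ x, smul_smul]
    norm_num
  refine nominalFeasible_iff.2 ⟨?_, ?_, ?_, ?_, fun k => ?_⟩
  · simp only [map_smul, map_add, ← a1, ← b1]
  · simp only [map_smul, map_add, ← a2, ← b2]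
  · simp only [map_smul, map_add, a3, b3, half]
  · simp only [map_smul, map_add, a4, b4, half]
  · have h := hU (a5 k) (b5 k) (a := 1 / 2) (b := 1 / 2) (by norm_num) (by norm_num) (by norm_num)
    rwa [← smul_add] at h

/-- The optimal input depends Hölder continuously on the noise level. -/
theorem exists_norm_sub_le_rpow (hU : IsPolytope U) (ud : Fin N → Fin m → ℝ)
    (yd : Fin N → Fin p → ℝ) {Q : Matrix (Fin p) (Fin p) ℝ} (hQ : Q.PosDef)
    {R : Matrix (Fin m) (Fin m) ℝ} (hR : R.PosDef) (reg : RegParams)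
    (hreg : reg.βα + reg.βσ < 2) (r V : ℝ) :
    ∃ γ C : ℝ, 0 < γ ∧ 0 ≤ C ∧ ∀ ε : ℝ, 0 < ε →
      ∀ εd : Fin N → Fin p → ℝ, (∀ k, ‖εd k‖ ≤ ε) → ∀ ν : Fin n → Fin p → ℝ, ‖ν‖ ≤ ε →
      ∀ ξ : ExtState n m p, ‖ξ.u‖ ≤ r → ‖ξ.y‖ ≤ r →
      ∀ (zbar : NominalVar n m p L N) (zhat : RobustVar n m p L N),
        NominalOptimal Q R U Set.univ ud yd ξ zbar → runningCost Q R zbar.u zbar.y ≤ V →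
        RobustOptimal Q R U reg ε ud (yd + εd) (ξ.addNoise ν) zhat →
          ‖zhat.u - zbar.u‖ ≤ C * ε ^ γ := by
  have hβα := reg.βα_pos
  have hβσ := reg.βσ_pos
  -- The first two bounds on g serve the cost comparison, the next two the prediction mismatch, and
  -- g ≤ 1 allows ε ≤ ε^g for the initial noise.
  obtain ⟨g, hg, hg₁, hg₂, hg₃, hg₄, hg₅⟩ : ∃ g : ℝ, 0 < g ∧ g ≤ reg.βα ∧ g ≤ 2 - reg.βσ ∧
      g ≤ reg.βσ / 2 ∧ g ≤ 1 - reg.βα / 2 ∧ g ≤ 1 := by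
    refine ⟨min reg.βα (min (2 - reg.βσ) (min (reg.βσ / 2) (min (1 - reg.βα / 2) 1))), ?_⟩
    simp only [lt_min_iff, min_le_iff, le_refl, true_or, or_true, and_true]
    exact ⟨hβα, by linarith, by linarith, by linarith, one_pos⟩
  obtain ⟨bU, hbU, HU⟩ := hU.exists_norm_le
  obtain ⟨b, hb, Hb⟩ := exists_norm_le_of_runningCost_le (n := n) (L := L) hQ hR r V
  obtain ⟨a₁, ha₁, H₁⟩ := exists_robustCost_le (n := n) (L := L) (U := U) (Q := Q) (R := R)
    ud yd reg hg₁ hg₂ b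
  obtain ⟨a₂, ha₂, H₂⟩ := exists_norm_signal_sub_le (n := n) (L := L) (U := U) hQ hR ud yd reg
    hg₃ hg₄ (V + a₁)
  obtain ⟨a₃, ha₃, H₃⟩ := exists_nominalFeasible_near (n := n) (L := L) hU ud yd
  obtain ⟨l, hl, Hl⟩ := exists_le_runningCost (n := n) (L := L) hQ hR
  obtain ⟨K, hK, HK⟩ := exists_runningCost_sub_le (n := n) (L := L) Q R
  -- Here d * ε^g is the distance to the nominal feasible set, b' bounds all predicted samples
  -- entering the Lipschitz estimate, and a * ε^g will be the suboptimality of the corrected point.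
  let d := a₃ * (a₂ + 1)
  have hd : 0 ≤ d := by positivity
  let b' := bU + √((V + a₁) / l) + d
  have hb' : 0 ≤ b' := by positivity
  let a := a₁ + K * b' * d
  have ha : 0 ≤ a := by positivity
  have hC : 0 ≤ √(2 * a / l) + d := by positivity
  refine ⟨g / 2, √(2 * a / l) + d + 2 * bU, by positivity, by positivity,
    fun ε hε εd hεd ν hν ξ hξu hξy zbar zhat hbar hV hhat => ?_⟩
  have hγ : 0 < ε ^ (g / 2) := Real.rpow_pos_of_pos hε _
  obtain ⟨hbarF, hbarO⟩ := hbar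
  obtain ⟨hhatF, hhatO⟩ := hhat
  rcases le_total 1 ε with hε1 | hε1
  · -- for large noise, boundedness of the inputs suffices
    have h : ‖zhat.u - zbar.u‖ ≤ 2 * bU := by
      refine norm_le_of_castAdd_of_natAdd (by positivity) (fun i => ?_) (fun k => ?_)
      · rw [Pi.sub_apply, (hhatF.initial i).1, (hbarF.initial i).1]
        simpa [ExtState.addNoise] using hbU
      · refine (norm_sub_le _ _).trans ?_
        linarith [HU _ (hhatF.constraints k), HU _ (hbarF.constraints k).1]
    have h1 : 1 ≤ ε ^ (g / 2) := Real.one_le_rpow hε1 (by positivity)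
    have h2 : 2 * bU * 1 ≤ 2 * bU * ε ^ (g / 2) := by gcongr
    have h3 : 0 ≤ (√(2 * a / l) + d) * ε ^ (g / 2) := by positivity
    linarith
  have hs : 0 < ε ^ g := Real.rpow_pos_of_pos hε _
  have hs1 : ε ^ g ≤ 1 := Real.rpow_le_one hε.le hε1 hg.le
  have hεs : ε ≤ ε ^ g := by
    conv_lhs => rw [← Real.rpow_one ε]
    exact Real.rpow_le_rpow_of_exponent_ge hε hε1 hg₅
  have hini := hbarF.norm_castAdd_le hξu hξy
  obtain ⟨z', hz', hcost⟩ := H₁ ε hε hε1 εd hεd ν hν ξ zbar hbarF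
    ((Hb _ _ hV).1 fun i => (hini i).1) ((Hb _ _ hV).2 fun i => (hini i).2)
  have hhat1 := (hhatO z' hz').trans hcost
  have hrun : runningCost Q R zhat.u zhat.y ≤ robustCost Q R reg ε zhat := by
    have p1 : 0 < ε ^ reg.βα := Real.rpow_pos_of_pos hε _
    have p2 : 0 < ε ^ reg.βσ := Real.rpow_pos_of_pos hε _
    have hlα := reg.lamα_pos
    have hlσ := reg.lamσ_pos
    have c2 : 0 ≤ reg.lamα * ε ^ reg.βα * norm2 zhat.α ^ 2 := by positivity
    have c3 : 0 ≤ reg.lamσ / ε ^ reg.βσ * norm2 (stack zhat.σ) ^ 2 := by positivity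
    unfold robustCost
    linarith
  have ha₁s : a₁ * ε ^ g ≤ a₁ := mul_le_of_le_one_right ha₁ hs1
  have hV2 : robustCost Q R reg ε zhat ≤ V + a₁ := by linarith
  have hsig := H₂ ε hε hε1 εd hεd _ zhat hhatF hV2
  have ha₂s : 0 ≤ a₂ * ε ^ g := by positivity
  obtain ⟨z, hz, hzu, hzy⟩ := H₃ ξ zbar hbarF (yd + εd) ν zhat hhatF ((a₂ + 1) * ε ^ g)
    (by linarith) (by linarith)
  rw [← mul_assoc] at hzu hzy
  change _ ≤ d * ε ^ g at hzu
  change _ ≤ d * ε ^ g at hzy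
  have hds : d * ε ^ g ≤ d := mul_le_of_le_one_right hd hs1
  have hyhat : ∀ k : Fin L, ‖zhat.y (Fin.natAdd n k)‖ ≤ √((V + a₁) / l) := fun k =>
    Real.le_sqrt_of_sq_le ((le_div_iff₀' hl).2 ((Hl _ _ k).2.trans (hrun.trans hV2)))
  have hsq : 0 ≤ √((V + a₁) / l) := Real.sqrt_nonneg _
  have hyk : ∀ k : Fin L, ‖z.y (Fin.natAdd n k) - zhat.y (Fin.natAdd n k)‖ ≤ d * ε ^ g :=
    fun k => (norm_le_pi_norm (z.y - zhat.y) _).trans hzy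
  have hJ := HK z.u zhat.u z.y zhat.y b' (d * ε ^ g)
    (fun k => by linarith [HU _ (hz.constraints k).1])
    (fun k => by linarith [HU _ (hhatF.constraints k)])
    (fun k => by
      have := norm_le_insert' (z.y (Fin.natAdd n k)) (zhat.y (Fin.natAdd n k))
      linarith [hyk k, hyhat k])
    (fun k => by linarith [hyhat k]) hzu hyk
  -- Optimality of `zbar` against the midpoint and the parallelogram identity give J(z - zbar) ≤ 2
  -- (J(z) - J(zbar)), and J(z) - J(zbar) ≤ a * ε^g.
  have hmid := hbarO _ (hz.midpoint hU.convex hbarF)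
  rw [runningCost_parallelogram] at hmid
  have hdiff : runningCost Q R (z.u - zbar.u) (z.y - zbar.y) ≤ 2 * a * ε ^ g := by
    have : 2 * a * ε ^ g = 2 * (a₁ * ε ^ g + K * b' * (d * ε ^ g)) := by simp only [a]; ring
    rw [this]
    linarith
  have hγ0 : 0 ≤ √(2 * a / l) * ε ^ (g / 2) := by positivity
  have h1 : ‖z.u - zbar.u‖ ≤ √(2 * a / l) * ε ^ (g / 2) := by
    -- Past inputs coincide; the cost of the difference controls the predicted ones.
    refine norm_le_of_castAdd_of_natAdd hγ0 (fun i => ?_) (fun k => ?_)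
    · rw [Pi.sub_apply, (hz.initial i).1, (hbarF.initial i).1]
      simpa using hγ0
    · have h2 := (Hl (z.u - zbar.u) (z.y - zbar.y) k).1.trans hdiff
      have h3 := le_sqrt_mul_rpow (β := -g) hl hε
        (x := ‖(z.u - zbar.u) (Fin.natAdd n k)‖) (V := 2 * a) (by
          rwa [Real.rpow_neg hε.le, mul_right_comm, ← div_eq_mul_inv, div_le_iff₀ hs])
      rwa [neg_neg] at h3
  have h2 : ε ^ g ≤ ε ^ (g / 2) := Real.rpow_le_rpow_of_exponent_ge hε hε1 (by linarith)
  have h3 : d * ε ^ g ≤ d * ε ^ (g / 2) := by gcongr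
  have h4 : 0 ≤ 2 * bU * ε ^ (g / 2) := by positivity
  have h5 := norm_sub_le_norm_sub_add_norm_sub zhat.u z.u zbar.u
  rw [norm_sub_rev zhat.u z.u] at h5
  linarith

theorem isKInf_mul_rpow {C : ℝ≥0} (hC : 0 < C) {γ : ℝ} (hγ : 0 < γ) :
    IsKInf fun x => C * x ^ γ where
  continuous := continuous_const.mul (NNReal.continuous_rpow_const hγ.le)
  strictMono x y h := mul_lt_mul_of_pos_left (NNReal.rpow_lt_rpow h hγ) hC
  unbounded := by
    rintro ⟨b, hb⟩
    have h := hb ⟨((b + 1) / C) ^ γ⁻¹, rfl⟩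
    dsimp only at h
    rw [NNReal.rpow_inv_rpow hγ.ne', mul_div_cancel₀ _ hC.ne'] at h
    exact absurd h (not_le.2 (lt_add_one b))
  map_zero := by simp [hγ.ne']

end Rate

end DDMPC

end

theorem mainTheorem1 {n m p L N : ℕ} (hL : n ≤ L)
    (S : DDMPC.LTI n m p) (hctrl : S.Controllable) (hobs : S.Observable)
    (ud : Fin N → Fin m → ℝ) (yd : Fin N → Fin p → ℝ) (hdata : S.IsTrajectory ud yd)
    (hpe : DDMPC.PersistentlyExciting (L + 2 * n) ud)
    (Q : Matrix (Fin p) (Fin p) ℝ) (hQ : Q.PosDef)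
    (R : Matrix (Fin m) (Fin m) ℝ) (hR : R.PosDef)
    (U : Set (Fin m → ℝ)) (hU : DDMPC.IsPolytope U)
    (P : Matrix ((Fin n × Fin m) ⊕ (Fin n × Fin p)) ((Fin n × Fin m) ⊕ (Fin n × Fin p)) ℝ)
    (hP : P.PosDef) (cIOSS : ℝ) (hc : 0 < cIOSS)
    (hIOSS : DDMPC.IsIOSS S Q R U Set.univ P cIOSS)
    (reg : DDMPC.RegParams) (hreg : reg.βα + reg.βσ < 2)
    (Vbar : ℝ) (hV : 0 < Vbar) :
    ∃ βu : ℝ≥0 → ℝ≥0, DDMPC.IsKInf βu ∧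
      ∀ εbar : ℝ≥0, 0 < εbar →
      -- noise in the data and in the initial conditions
      ∀ εd : Fin N → Fin p → ℝ, (∀ k, DDMPC.norm2 (εd k) ≤ εbar) →
      ∀ ε : Fin n → Fin p → ℝ, (∀ k, DDMPC.norm2 (ε k) ≤ εbar) →
      ∀ ξ : DDMPC.ExtState n m p,
        DDMPC.lyapunov L Q R U Set.univ ud yd P cIOSS ξ ≤ (Vbar : EReal) →
        (∃ z : DDMPC.NominalVar n m p L N,
          DDMPC.NominalOptimal Q R U Set.univ ud yd ξ z) ∧
        (∃ z : DDMPC.RobustVar n m p L N,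
          DDMPC.RobustOptimal Q R U reg εbar ud (yd + εd) (ξ.addNoise ε) z) ∧
        ∀ (zbar : DDMPC.NominalVar n m p L N) (zhat : DDMPC.RobustVar n m p L N),
          DDMPC.NominalOptimal Q R U Set.univ ud yd ξ zbar →
          DDMPC.RobustOptimal Q R U reg εbar ud (yd + εd) (ξ.addNoise ε) zhat →
          DDMPC.norm2 (DDMPC.stack (zhat.u - zbar.u)) ≤ βu εbar := by 
  obtain ⟨l, hl, Hl⟩ := DDMPC.exists_le_wnormSq hP
  obtain ⟨γ, C, hγ, hC, H⟩ := DDMPC.exists_norm_sub_le_rpow (n := n) (L := L) hU ud yd hQ hR reg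
    hreg √(cIOSS * Vbar / l) (Vbar + 1)
  let D : ℝ := Fintype.card (Fin (n + L) × Fin m)
  have hD : 0 ≤ D := Nat.cast_nonneg _
  -- D converts the sup norm into the Euclidean norm; the added 1 keeps K positive, hence βu
  -- strictly increasing and unbounded, even if D * C = 0.
  obtain ⟨K, hK⟩ : ∃ K : ℝ≥0, (K : ℝ) = D * C + 1 := ⟨_, Real.coe_toNNReal _ (by positivity)⟩
  have hK0 : 0 < K := NNReal.coe_pos.1 (hK ▸ (by positivity : 0 < D * C + 1))
  refine ⟨fun x => K * x ^ γ, DDMPC.isKInf_mul_rpow hK0 hγ, ?_⟩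
  intro εbar hε εd hεd ε hεini ξ hξ
  have hε' : (0 : ℝ) < εbar := NNReal.coe_pos.2 hε
  obtain ⟨⟨z, hz, hzV⟩, hw⟩ := DDMPC.exists_of_lyapunov_le hQ hR hP hc hξ
  have hvec : ‖ξ.vec‖ ≤ √(cIOSS * Vbar / l) :=
    Real.le_sqrt_of_sq_le ((le_div_iff₀' hl).2 ((Hl _).trans hw))
  obtain ⟨hξu, hξy⟩ := DDMPC.ExtState.norm_le hvec
  refine ⟨DDMPC.exists_nominalOptimal hU.1.isClosed hQ hR hz,
    DDMPC.exists_robustOptimal hU.1.isClosed hQ hR reg hε'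
      (DDMPC.robustFeasible_of_nominalFeasible hz εd ε), fun zbar zhat hbar hhat => ?_⟩
  -- Any nominal optimum costs no more than the feasible point `z`, hence at most Vbar + 1.
  have h1 := H εbar hε' εd (fun k => (DDMPC.norm_le_norm2 _).trans (hεd k)) ε
    ((pi_norm_le_iff_of_nonneg hε'.le).2 fun k => (DDMPC.norm_le_norm2 _).trans (hεini k))
    ξ hξu hξy zbar zhat hbar ((hbar.2 z hz).trans hzV) hhat
  have h2 := DDMPC.norm2_le (DDMPC.stack (zhat.u - zbar.u))
  rw [DDMPC.norm_stack] at h2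
  have h3 := mul_le_mul_of_nonneg_left h1 hD
  have h4 : 0 ≤ (εbar : ℝ) ^ γ := Real.rpow_nonneg hε'.le _
  rw [NNReal.coe_mul, NNReal.coe_rpow, hK]
  linarith
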